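/- **Setting.** Fix an infinite countable set of variables. *The theory CaTT.* Raw expressions are: types $A ::= \star \mid t\to_A u$; terms $t ::= x \mid \mathrm{op}_{\Gamma,A}[\gamma] \mid \mathrm{coh}_{\Gamma,A}[\gamma]$; contexts $\Gamma$, lists of declarations $x:A$; substitutions $\gamma$, lists of assignments $x\mapsto t$. Substitutions act in the usual way, with $\mathrm{op}_{\Gamma,A}[\gamma][\delta]=\mathrm{op}_{\Gamma,A}[\gamma\circ\delta]$, and similarly for $\mathrm{coh}$. Give a variable dimension $0$ if its type is $\star$, and dimension $n+1$ if its type is $t\to_A u$, where $n$ is the dimension of variables of type $A$; $\dim\Gamma$ is the largest dimension of a variable of $\Gamma$. A *ps-context* is a context $\Gamma$ with $\Gamma\vdash_{ps}x:\star$ for some $x$, where: $(x:\star)\vdash_{ps}x:\star$; if $\Gamma\vdash_{ps}f:x\to_A y$ then $\Gamma\vdash_{ps}y:A$; if $\Gamma\vdash_{ps}x:A$ and $y,f$ are distinct fresh variables then $(\Gamma,y:A,f:x\to_A y)\vdash_{ps}f:x\to_A y$. For a ps-context put $\partial^\pm_i(x:\star)=(x:\star)$ and, for $k$ the dimension of $y$,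 $$\partial^-_i(\Gamma,y:A,f:x\to_A y)=\begin{cases}\partial^-_i\Gamma & i\le k\\ (\partial^-_i\Gamma,y:A,f:x\to_A y)&\text{otherwise,}\end{cases}$$ $$\partial^+_i(\Gamma,y:A,f:x\to_A y)=\begin{cases}\partial^+_i\Gamma & i<k\\ (\mathrm{drop}(\partial^+_i\Gamma),y:A)& i=k\\ (\partial^+_i\Gamma,y:A,f:x\to_A y)&\text{otherwise,}\end{cases}$$ where $\mathrm{drop}$ removes the last variable, and $\partial^\pm\Gamma=\partial^\pm_{\dim\Gamma-1}\Gamma$ if $\dim\Gamma\ge1$. Write $\mathrm{Var}$ for the set of variables that occur in an expression (for a context, that it declares). The rules are: - $\varnothing\vdash$; if $\Gamma\vdash A$ and $x\notin\mathrm{Var}(\Gamma)$, then $(\Gamma,x:A)\vdash$. - If $\Gamma\vdash$, then $\Gamma\vdash\star$; if $\Gamma\vdash t:A$ and $\Gamma\vdash u:A$, then $\Gamma\vdash t\to_A u$. - If $\Gamma\vdash$ and $(x:A)\in\Gamma$, then $\Gamma\vdash x:A$. - If $\Delta\vdash$, then $\Delta\vdash\langle\rangle:\varnothing$; if $\Delta\vdash\gamma:\Gamma$,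 $\Gamma\vdash A$, $x\notin\mathrm{Var}(\Gamma)$ and $\Delta\vdash t:A[\gamma]$, then $\Delta\vdash\langle\gamma,x\mapsto t\rangle:(\Gamma,x:A)$. - $\Gamma\vdash_{op}t\to_A u$ if $\Gamma$ is a ps-context of dimension at least $1$, $\partial^-\Gamma\vdash t:A$, $\partial^+\Gamma\vdash u:A$, $\mathrm{Var}(t)\cup\mathrm{Var}(A)=\mathrm{Var}(\partial^-\Gamma)$ and $\mathrm{Var}(u)\cup\mathrm{Var}(A)=\mathrm{Var}(\partial^+\Gamma)$. - $\Gamma\vdash_{eq}t\to_A u$ if $\Gamma$ is a ps-context, $\Gamma\vdash t:A$, $\Gamma\vdash u:A$ and $\mathrm{Var}(t)\cup\mathrm{Var}(A)=\mathrm{Var}(\Gamma)=\mathrm{Var}(u)\cup\mathrm{Var}(A)$. - If $\Gamma\vdash_{op}A$ and $\Delta\vdash\gamma:\Gamma$, then $\Delta\vdash\mathrm{op}_{\Gamma,A}[\gamma]:A[\gamma]$; similarly for $\mathrm{coh}$, with $\vdash_{eq}$. The category $\mathrm{Syn}(\mathrm{CaTT})$ has as objects the derivable contexts and as morphisms $\Delta\to\Gamma$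 the derivable substitutions $\Delta\vdash\gamma:\Gamma$. *The theory MCaTT and the desuspension.* Raw types are $A::=\mathbb 1\mid t\to_A u$ and raw terms are $t::=x\mid()\mid\mathrm{mop}_{\Gamma,A}[\gamma]\mid\mathrm{mcoh}_{\Gamma,A}[\gamma]$, where $\Gamma$ and $A$ are a context and a type of CaTT and $\gamma$ is a substitution of MCaTT. The *desuspension* $\downarrow$ from expressions of CaTT to those of MCaTT is given by $\downarrow\star=\mathbb 1$, $\downarrow(t\to_A u)=(\downarrow t\to_{\downarrow A}\downarrow u)$, $\downarrow x=x$, $\downarrow\mathrm{op}_{\Gamma,A}[\gamma]=\mathrm{mop}_{\Gamma,A}[\downarrow\gamma]$, $\downarrow\mathrm{coh}_{\Gamma,A}[\gamma]=\mathrm{mcoh}_{\Gamma,A}[\downarrow\gamma]$, and entry by entry on contexts and substitutions. MCaTT has the same rules for contexts, variables, substitutions and arrow types; the rules that $\Gamma\vdash\mathbb 1$ and $\Gamma\vdash():\mathbb 1$ if $\Gamma\vdash$; the rule that, if $\Gamma$ is a ps-context, $\Gamma\vdash_{op}A$ in CaTT and $\Delta\vdash\gamma:\downarrow\Gamma$,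 then $\Delta\vdash\mathrm{mop}_{\Gamma,A}[\gamma]:(\downarrow A)[\gamma]$; and similarly for $\mathrm{mcoh}$, with $\vdash_{eq}$. Definitional equality is the congruence generated by $\Gamma\vdash t\equiv u:\mathbb 1$ for all $\Gamma\vdash t:\mathbb 1$ and $\Gamma\vdash u:\mathbb 1$, and terms may be converted along definitionally equal types. Two contexts are definitionally equal if they declare the same variables in the same order, with definitionally equal types. The category $\mathrm{Syn}(\mathrm{MCaTT})$ has as objects the derivable contexts, and as morphisms the derivable substitutions, both up to definitional equality. The desuspension induces a functor $\downarrow:\mathrm{Syn}(\mathrm{CaTT})\to\mathrm{Syn}(\mathrm{MCaTT})$. *The reduced suspension.* Fix a function assigning to each finite set $s$ of variables a variable $\mathrm{new}(s)\notin s$. For a context $\Gamma$ of MCaTT let $\bullet=\bullet^\Gamma$ be $\mathrm{new}(s)$, where $s$ is the set of the variables of $\Gamma$ whose type is not $\mathbb 1$. The *reduced suspension* $\uparrow$ of the expressions over $\Gamma$ is given by $$\uparrow\mathbb 1=\star,\qquad \uparrow(t\to_A u)=(\uparrow t\to_{\uparrow A}\uparrow u),\qquad \uparrow()=\bullet,\qquad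 \uparrow x=\begin{cases}\bullet & \text{if } x:\mathbb 1\text{ in }\Gamma\\ x&\text{otherwise,}\end{cases}$$ $$\uparrow\mathrm{mop}_{\Theta,A}[\gamma]=\mathrm{op}_{\Theta,A}[\bullet_\Theta\circ\uparrow\gamma],\qquad \uparrow\mathrm{mcoh}_{\Theta,A}[\gamma]=\mathrm{coh}_{\Theta,A}[\bullet_\Theta\circ\uparrow\gamma].$$ The context $\uparrow\Gamma$ consists of $\bullet:\star$ followed by the declarations $x:\uparrow A$ for those $x:A$ in $\Gamma$ with $A\ne\mathbb 1$, in the same order. For $\Delta\vdash\gamma:\Gamma$, the substitution $\uparrow\gamma:\uparrow\Delta\to\uparrow\Gamma$ consists of $\bullet^\Gamma\mapsto\bullet^\Delta$ followed by $x\mapsto\uparrow t$ for those entries $x\mapsto t$ of $\gamma$ for which the type of $x$ in $\Gamma$ is not $\mathbb 1$. For a context $\Gamma$ of CaTT, $\bullet_\Gamma:\uparrow\downarrow\Gamma\to\Gamma$ is the substitution with $x\mapsto\bullet$ if $x$ has type $\star$ in $\Gamma$ and $x\mapsto x$ otherwise. The reduced suspension induces a functor $\uparrow:\mathrm{Syn}(\mathrm{MCaTT})\to\mathrm{Syn}(\mathrm{CaTT})$.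 For a context $\Gamma$ of MCaTT, $\eta_\Gamma:\Gamma\to\downarrow\uparrow\Gamma$ is the substitution with $\bullet\mapsto()$ and $x\mapsto x$ for the variables $x$ of $\Gamma$ whose type is not $\mathbb 1$. **Theorem.** For every such function $\mathrm{new}$, the reduced suspension functor $\uparrow:\mathrm{Syn}(\mathrm{MCaTT})\to\mathrm{Syn}(\mathrm{CaTT})$ is left adjoint to the desuspension functor $\downarrow:\mathrm{Syn}(\mathrm{CaTT})\to\mathrm{Syn}(\mathrm{MCaTT})$, by an adjunction whose counit is the family of the substitutions $\bullet_\Gamma:\uparrow\downarrow\Gamma\to\Gamma$ and whose unit is the family of the (classes of the derivable) substitutions $\eta_\Gamma:\Gamma\to\downarrow\uparrow\Gamma$. The unit $\eta$ is a natural isomorphism, so the adjunction is coreflective: $\uparrow$ is full and faithful. -/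

import Mathlib

open CategoryTheory

/-- The countably infinite set of variables. -/
abbrev Var : Type := ℕ

/-- The two families of term constructors: operations and coherences. -/
inductive Kind : Type
  | op
  | coh

/-! ## The type theory `CaTT` -/

namespace CaTT

/-! ### Raw syntax -/

mutual
/-- Raw types: `⋆` and `t →_A u`. -/
inductive Ty : Type
  | obj : Ty
  | hom : Ty → Tm → Tm → Ty
/-- Raw terms: variables, `op_{Γ,A}[γ]` and `coh_{Γ,A}[γ]`. -/
inductive Tm : Type
  | var : Var → Tm
  | constr : Kind → Ctx → Ty → Sub → Tm
/-- Raw contexts: lists of declarations `x : A`, extended on the right. -/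
inductive Ctx : Type
  | nil : Ctx
  | cons : Ctx → Var → Ty → Ctx
/-- Raw substitutions: lists of assignments `x ↦ t`, extended on the right. -/
inductive Sub : Type
  | nil : Sub
  | cons : Sub → Var → Tm → Sub
end

mutual
def Ty.vars : Ty → Finset Var
  | .obj => ∅
  | .hom A t u => A.vars ∪ t.vars ∪ u.vars
def Tm.vars : Tm → Finset Var
  | .var x => {x}
  | .constr _ _ _ γ => γ.vars
def Sub.vars : Sub → Finset Var
  | .nil => ∅
  | .cons γ _ t => γ.vars ∪ t.vars
end

/-- The variables declared by a context. -/
def Ctx.vars : Ctx → Finset Var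
  | .nil => ∅
  | .cons Γ x _ => insert x Γ.vars

/-- `Γ.Mem x A` means `(x : A) ∈ Γ`. -/
def Ctx.Mem (x : Var) (A : Ty) : Ctx → Prop
  | .nil => False
  | .cons Γ y B => (x = y ∧ A = B) ∨ Ctx.Mem x A Γ

/-- The action `x[γ]` of a substitution on a variable. -/
def Sub.get : Sub → Var → Tm
  | .nil, x => .var x
  | .cons γ y t, x => if x = y then t else γ.get x

mutual
/-- `A[σ]` -/
def Ty.subst : Ty → Sub → Ty
  | .obj, _ => .obj
  | .hom A t u, σ => .hom (A.subst σ) (t.subst σ) (u.subst σ)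
/-- `t[σ]` -/
def Tm.subst : Tm → Sub → Tm
  | .var x, σ => σ.get x
  | .constr k Γ A γ, σ => .constr k Γ A (γ.comp σ)
/-- `γ.comp σ` is the composite `γ ∘ σ`. -/
def Sub.comp : Sub → Sub → Sub
  | .nil, _ => .nil
  | .cons γ x t, σ => .cons (γ.comp σ) x (t.subst σ)
end

/-- The identity substitution of a context. -/
def Ctx.id : Ctx → Sub
  | .nil => .nil
  | .cons Γ x _ => .cons Γ.id x (.var x)

/-! ### Pasting schemes -/

/-- The dimension of the variables of a given type: `0` for `⋆`. (This is one more than the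
dimension of the type itself, in the convention where `⋆` has dimension `-1`.) -/
def Ty.cellDim : Ty → ℕ
  | .obj => 0
  | .hom A _ _ => A.cellDim + 1

/-- The dimension of a context: the largest dimension of a variable. -/
def Ctx.dim : Ctx → ℕ
  | .nil => 0
  | .cons Γ _ A => max Γ.dim A.cellDim

/-- `Ps Γ x A` is the judgment `Γ ⊢ps x : A`. A ps-context is in particular a context, so the
two variables added by the rule `pse` are new and distinct. -/
inductive Ps : Ctx → Var → Ty → Prop
  | pss (x : Var) : Ps (.cons .nil x .obj) x .obj
  | psd {Γ : Ctx} {f x y : Var} {A : Ty} :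
      Ps Γ f (.hom A (.var x) (.var y)) → Ps Γ y A
  | pse {Γ : Ctx} {x y f : Var} {A : Ty} :
      Ps Γ x A → y ∉ Γ.vars → f ∉ Γ.vars → f ≠ y →
      Ps (.cons (.cons Γ y A) f (.hom A (.var x) (.var y))) f (.hom A (.var x) (.var y))

/-- `Γ ⊢ps` -/
def IsPs (Γ : Ctx) : Prop := ∃ x, Ps Γ x .obj

/-- A context with its last variable removed. -/
def Ctx.drop : Ctx → Ctx
  | .nil => .nil
  | .cons Γ _ _ => Γ

/-- The `i`-source `∂⁻ᵢ Γ` of a ps-context. -/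
def Ctx.srcAt (i : ℕ) : Ctx → Ctx
  | .cons (.cons Γ y A) f B =>
      if i ≤ A.cellDim then Γ.srcAt i else .cons (.cons (Γ.srcAt i) y A) f B
  | .cons .nil x A => .cons .nil x A
  | .nil => .nil

/-- The `i`-target `∂⁺ᵢ Γ` of a ps-context. -/
def Ctx.tgtAt (i : ℕ) : Ctx → Ctx
  | .cons (.cons Γ y A) f B =>
      if i < A.cellDim then Γ.tgtAt i
      else if A.cellDim = i then .cons (Γ.tgtAt i).drop y A
      else .cons (.cons (Γ.tgtAt i) y A) f B
  | .cons .nil x A => .cons .nil x A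
  | .nil => .nil

/-- `∂⁻ Γ`, meaningful when `1 ≤ dim Γ`. -/
def Ctx.src (Γ : Ctx) : Ctx := Γ.srcAt (Γ.dim - 1)

/-- `∂⁺ Γ`, meaningful when `1 ≤ dim Γ`. -/
def Ctx.tgt (Γ : Ctx) : Ctx := Γ.tgtAt (Γ.dim - 1)

/-! ### Judgments and rules -/

/-- The judgments of `CaTT`: `Γ ⊢`, `Γ ⊢ A`, `Γ ⊢ t : A`, `Δ ⊢ γ : Γ`, and `Γ ⊢op A`
(for `cell .op Γ A`) and `Γ ⊢eq A` (for `cell .coh Γ A`). -/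
inductive Judgment : Type
  | ctx : Ctx → Judgment
  | ty : Ctx → Ty → Judgment
  | tm : Ctx → Tm → Ty → Judgment
  | sub : Ctx → Sub → Ctx → Judgment
  | cell : Kind → Ctx → Ty → Judgment

/-- Derivability in `CaTT`. -/
inductive Der : Judgment → Prop
  | ec : Der (.ctx .nil)
  | ce {Γ : Ctx} {x : Var} {A : Ty} :
      Der (.ty Γ A) → x ∉ Γ.vars → Der (.ctx (.cons Γ x A))
  | obj {Γ : Ctx} : Der (.ctx Γ) → Der (.ty Γ .obj)
  | hom {Γ : Ctx} {A : Ty} {t u : Tm} :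
      Der (.tm Γ t A) → Der (.tm Γ u A) → Der (.ty Γ (.hom A t u))
  | var {Γ : Ctx} {x : Var} {A : Ty} :
      Der (.ctx Γ) → Γ.Mem x A → Der (.tm Γ (.var x) A)
  | constr {k : Kind} {Γ Δ : Ctx} {A : Ty} {γ : Sub} :
      Der (.cell k Γ A) → Der (.sub Δ γ Γ) → Der (.tm Δ (.constr k Γ A γ) (A.subst γ))
  | es {Δ : Ctx} : Der (.ctx Δ) → Der (.sub Δ .nil .nil)
  | se {Δ Γ : Ctx} {γ : Sub} {x : Var} {A : Ty} {t : Tm} :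
      Der (.sub Δ γ Γ) → Der (.ty Γ A) → x ∉ Γ.vars → Der (.tm Δ t (A.subst γ)) →
      Der (.sub Δ (.cons γ x t) (.cons Γ x A))
  | op {Γ : Ctx} {A : Ty} {t u : Tm} :
      IsPs Γ → 1 ≤ Γ.dim → Der (.tm Γ.src t A) → Der (.tm Γ.tgt u A) →
      t.vars ∪ A.vars = Γ.src.vars → u.vars ∪ A.vars = Γ.tgt.vars →
      Der (.cell .op Γ (.hom A t u))
  | coh {Γ : Ctx} {A : Ty} {t u : Tm} :
      IsPs Γ → Der (.tm Γ t A) → Der (.tm Γ u A) →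
      t.vars ∪ A.vars = Γ.vars → u.vars ∪ A.vars = Γ.vars →
      Der (.cell .coh Γ (.hom A t u))

/-! ### The substitution calculus -/

/-- The variables to which a substitution assigns a term. -/
def Sub.dom : Sub → Finset Var
  | .nil => ∅
  | .cons γ x _ => insert x γ.dom

mutual
theorem Ty.subst_congr {σ τ : Sub} :
    ∀ A : Ty, (∀ x ∈ A.vars, σ.get x = τ.get x) → A.subst σ = A.subst τ
  | .obj, _ => rfl
  | .hom A t u, h => by
      simp only [Ty.vars, Finset.mem_union] at h
      simp only [Ty.subst]
      rw [A.subst_congr fun x hx => h x (.inl (.inl hx)),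
        t.subst_congr fun x hx => h x (.inl (.inr hx)),
        u.subst_congr fun x hx => h x (.inr hx)]
theorem Tm.subst_congr {σ τ : Sub} :
    ∀ t : Tm, (∀ x ∈ t.vars, σ.get x = τ.get x) → t.subst σ = t.subst τ
  | .var x, h => by simpa [Tm.subst, Tm.vars] using h
  | .constr k Γ A γ, h => by
      simp only [Tm.subst]
      rw [Sub.comp_congr γ (by simpa only [Tm.vars] using h)]
theorem Sub.comp_congr {σ τ : Sub} :
    ∀ γ : Sub, (∀ x ∈ γ.vars, σ.get x = τ.get x) → γ.comp σ = γ.comp τ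
  | .nil, _ => rfl
  | .cons γ x t, h => by
      simp only [Sub.vars, Finset.mem_union] at h
      simp only [Sub.comp]
      rw [Sub.comp_congr γ fun x hx => h x (.inl hx), t.subst_congr fun x hx => h x (.inr hx)]
end

mutual
theorem Ty.subst_eq_self {σ : Sub} (h : ∀ x, σ.get x = .var x) : ∀ A : Ty, A.subst σ = A
  | .obj => rfl
  | .hom A t u => by
      simp only [Ty.subst]
      rw [A.subst_eq_self h, t.subst_eq_self h, u.subst_eq_self h]
theorem Tm.subst_eq_self {σ : Sub} (h : ∀ x, σ.get x = .var x) : ∀ t : Tm, t.subst σ = t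
  | .var x => h x
  | .constr k Γ A γ => by
      simp only [Tm.subst]
      rw [Sub.comp_eq_self h γ]
theorem Sub.comp_eq_self {σ : Sub} (h : ∀ x, σ.get x = .var x) : ∀ γ : Sub, γ.comp σ = γ
  | .nil => rfl
  | .cons γ x t => by
      simp only [Sub.comp]
      rw [Sub.comp_eq_self h γ, t.subst_eq_self h]
end

theorem Sub.get_comp {σ : Sub} {x : Var} :
    ∀ {γ : Sub}, x ∈ γ.dom → (γ.comp σ).get x = (γ.get x).subst σ
  | .nil, h => by simp [Sub.dom] at h
  | .cons γ y t, h => by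
      by_cases hxy : x = y
      · simp [Sub.comp, Sub.get, hxy]
      · have : x ∈ γ.dom := by simpa [Sub.dom, hxy] using h
        simpa [Sub.comp, Sub.get, hxy] using Sub.get_comp this

mutual
theorem Ty.subst_comp {γ σ : Sub} :
    ∀ A : Ty, A.vars ⊆ γ.dom → A.subst (γ.comp σ) = (A.subst γ).subst σ
  | .obj, _ => rfl
  | .hom A t u, h => by
      simp only [Ty.vars, Finset.union_subset_iff] at h
      simp only [Ty.subst]
      rw [A.subst_comp h.1.1, t.subst_comp h.1.2, u.subst_comp h.2]
theorem Tm.subst_comp {γ σ : Sub} :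
    ∀ t : Tm, t.vars ⊆ γ.dom → t.subst (γ.comp σ) = (t.subst γ).subst σ
  | .var x, h => by
      simp only [Tm.vars, Finset.singleton_subset_iff] at h
      simpa only [Tm.subst] using Sub.get_comp h
  | .constr k Γ A δ, h => by
      simp only [Tm.subst]
      rw [Sub.comp_assoc δ (by simpa only [Tm.vars] using h)]
theorem Sub.comp_assoc {γ σ : Sub} :
    ∀ δ : Sub, δ.vars ⊆ γ.dom → δ.comp (γ.comp σ) = (δ.comp γ).comp σ
  | .nil, _ => rfl
  | .cons δ x t, h => by
      simp only [Sub.vars, Finset.union_subset_iff] at h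
      simp only [Sub.comp]
      rw [Sub.comp_assoc δ h.1, t.subst_comp h.2]
end

theorem Ctx.get_id (x : Var) : ∀ Γ : Ctx, Γ.id.get x = .var x
  | .nil => rfl
  | .cons Γ y A => by
      by_cases h : x = y
      · simp [Ctx.id, Sub.get, h]
      · simpa [Ctx.id, Sub.get, h] using Γ.get_id x

theorem Ctx.vars_id : ∀ Γ : Ctx, Γ.id.vars = Γ.vars
  | .nil => rfl
  | .cons Γ y A => by
      have := Γ.vars_id
      simp only [Ctx.id, Sub.vars, Ctx.vars, Tm.vars]
      grind

theorem Ctx.Mem.mem_vars {x : Var} {A : Ty} : ∀ {Γ : Ctx}, Γ.Mem x A → x ∈ Γ.vars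
  | .nil, h => h.elim
  | .cons Γ y B, h => by
      rcases h with ⟨rfl, _⟩ | h
      · simp [Ctx.vars]
      · simp [Ctx.vars, Ctx.Mem.mem_vars h]

theorem vars_srcAt (i : ℕ) : ∀ Γ : Ctx, (Γ.srcAt i).vars ⊆ Γ.vars
  | .cons (.cons Γ y A) f B => by
      have := vars_srcAt i Γ
      rw [Ctx.srcAt]
      split_ifs <;> simp only [Ctx.vars] <;> grind
  | .cons .nil x A => by simp [Ctx.srcAt]
  | .nil => by simp [Ctx.srcAt]

theorem vars_drop (Γ : Ctx) : Γ.drop.vars ⊆ Γ.vars := by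
  cases Γ <;> simp [Ctx.drop, Ctx.vars]

theorem vars_tgtAt (i : ℕ) : ∀ Γ : Ctx, (Γ.tgtAt i).vars ⊆ Γ.vars
  | .cons (.cons Γ y A) f B => by
      have h1 := vars_tgtAt i Γ
      have h2 := vars_drop (Γ.tgtAt i)
      rw [Ctx.tgtAt]
      split_ifs <;> simp only [Ctx.vars] <;> grind
  | .cons .nil x A => by simp [Ctx.tgtAt]
  | .nil => by simp [Ctx.tgtAt]

theorem Der.sub_dom {Δ : Ctx} : ∀ {Γ : Ctx} {γ : Sub}, Der (.sub Δ γ Γ) → γ.dom = Γ.vars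
  | _, .nil, h => by cases h; rfl
  | _, .cons γ x t, h => by
      cases h with
      | se h1 _ _ _ => simp [Sub.dom, Ctx.vars, h1.sub_dom]

theorem Der.vars_cell {k : Kind} {Γ : Ctx} {A : Ty} (h : Der (.cell k Γ A)) :
    A.vars ⊆ Γ.vars := by
  cases h with
  | op _ _ _ _ h1 h2 =>
      have h3 := vars_srcAt (Γ.dim - 1) Γ
      have h4 := vars_tgtAt (Γ.dim - 1) Γ
      simp only [Ctx.src, Ctx.tgt] at h1 h2
      simp only [Ty.vars]
      grind
  | coh _ _ _ h1 h2 =>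
      simp only [Ty.vars]
      grind

/-- Every derivable judgment has a derivable underlying context. -/
theorem Der.ctx_of {J : Judgment} (h : Der J) :
    match J with
    | .ctx Γ => Der (.ctx Γ)
    | .ty Γ _ => Der (.ctx Γ)
    | .tm Γ _ _ => Der (.ctx Γ)
    | .sub Δ _ _ => Der (.ctx Δ)
    | .cell _ _ _ => True := by
  induction h with
  | ec => exact .ec
  | ce h hx _ => exact .ce h hx
  | obj h _ => exact h
  | hom _ _ h _ => exact h
  | var h _ _ => exact h
  | constr _ _ _ h => exact h
  | es h _ => exact h
  | se _ _ _ _ h _ _ => exact h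
  | op => trivial
  | coh => trivial

theorem Sub.vars_get {γ : Sub} {x : Var} : x ∈ γ.dom → (γ.get x).vars ⊆ γ.vars := by
  intro h
  match γ, h with
  | .nil, h => simp [Sub.dom] at h
  | .cons γ y t, h =>
      by_cases hxy : x = y
      · simp [Sub.get, Sub.vars, hxy]
      · have h' : x ∈ γ.dom := by simpa [Sub.dom, hxy] using h
        have := Sub.vars_get h'
        simp only [Sub.get, Sub.vars, hxy, if_false]
        grind

mutual
theorem Ty.vars_subst {γ : Sub} : ∀ A : Ty, A.vars ⊆ γ.dom → (A.subst γ).vars ⊆ γ.vars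
  | .obj, _ => by simp [Ty.subst, Ty.vars]
  | .hom A t u, h => by
      simp only [Ty.vars, Finset.union_subset_iff] at h
      have h1 := A.vars_subst h.1.1
      have h2 := t.vars_subst h.1.2
      have h3 := u.vars_subst h.2
      simp only [Ty.subst, Ty.vars]
      grind
theorem Tm.vars_subst {γ : Sub} : ∀ t : Tm, t.vars ⊆ γ.dom → (t.subst γ).vars ⊆ γ.vars
  | .var x, h => by
      simp only [Tm.vars, Finset.singleton_subset_iff] at h
      simpa only [Tm.subst] using Sub.vars_get h
  | .constr k Γ A δ, h => by
      simp only [Tm.subst, Tm.vars]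
      exact Sub.vars_comp δ (by simpa only [Tm.vars] using h)
theorem Sub.vars_comp {γ : Sub} : ∀ δ : Sub, δ.vars ⊆ γ.dom → (δ.comp γ).vars ⊆ γ.vars
  | .nil, _ => by simp [Sub.comp, Sub.vars]
  | .cons δ x t, h => by
      simp only [Sub.vars, Finset.union_subset_iff] at h
      have h1 := Sub.vars_comp δ h.1
      have h2 := t.vars_subst h.2
      simp only [Sub.comp, Sub.vars]
      grind
end

/-- All types declared in a context only use variables of this context. -/
def Ctx.Scoped (Γ : Ctx) : Prop := ∀ x A, Γ.Mem x A → A.vars ⊆ Γ.vars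

/-- The variables of a derivable expression are declared in its context. -/
theorem Der.scoped {J : Judgment} (h : Der J) :
    match J with
    | .ctx Γ => Γ.Scoped
    | .ty Γ A => A.vars ⊆ Γ.vars ∧ Γ.Scoped
    | .tm Γ t A => t.vars ⊆ Γ.vars ∧ A.vars ⊆ Γ.vars ∧ Γ.Scoped
    | .sub Δ γ _ => γ.vars ⊆ Δ.vars ∧ Δ.Scoped
    | .cell _ _ _ => True := by
  induction h with
  | ec => intro x A h; exact h.elim
  | @ce Γ x A _ hx ih =>
      rintro y B (⟨rfl, rfl⟩ | h)
      · exact ih.1.trans (by simp [Ctx.vars])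
      · exact (ih.2 y B h).trans (by simp [Ctx.vars])
  | obj h ih => exact ⟨by simp [Ty.vars], ih⟩
  | hom _ _ h1 h2 =>
      refine ⟨?_, h1.2.2⟩
      simp only [Ty.vars]
      exact Finset.union_subset (Finset.union_subset h1.2.1 h1.1) h2.1
  | @var Γ x A h hm ih =>
      exact ⟨by simpa [Tm.vars] using hm.mem_vars, ih _ _ hm, ih⟩
  | @constr k Γ Δ A γ hc hs _ ih =>
      refine ⟨by simpa [Tm.vars] using ih.1, ?_, ih.2⟩
      exact (A.vars_subst (by rw [hs.sub_dom]; exact hc.vars_cell)).trans ih.1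
  | es h ih => exact ⟨by simp [Sub.vars], ih⟩
  | se _ _ _ _ h1 _ h2 =>
      refine ⟨?_, h1.2⟩
      simp only [Sub.vars]
      exact Finset.union_subset h1.1 h2.1
  | op => trivial
  | coh => trivial

/-- Substitution acts on the variables of its target. -/
theorem Der.get {Δ : Ctx} {x : Var} {B : Ty} : ∀ {Γ : Ctx} {γ : Sub},
    Der (.sub Δ γ Γ) → Γ.Mem x B → Der (.tm Δ (γ.get x) (B.subst γ))
  | .nil, _, _, hm => hm.elim
  | .cons Γ y A, _, h, hm => by
      cases h with
      | @se _ _ γ _ _ t h1 h2 h3 h4 =>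
        have key : ∀ C : Ty, C.vars ⊆ Γ.vars → C.subst (γ.cons y t) = C.subst γ := by
          intro C hC
          refine C.subst_congr fun z hz => ?_
          have : z ≠ y := fun e => h3 (e ▸ hC hz)
          simp [Sub.get, this]
        rcases hm with ⟨rfl, rfl⟩ | hm
        · rw [key B h2.scoped.1]
          simpa [Sub.get] using h4
        · have : x ≠ y := fun e => h3 (e ▸ hm.mem_vars)
          rw [key B (h2.scoped.2 _ _ hm)]
          simpa [Sub.get, this] using h1.get hm

/-- Derivable judgments are stable under substitution. -/
theorem Der.subst {J : Judgment} (h : Der J) :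
    match J with
    | .ctx _ => True
    | .ty Γ A => ∀ {Λ σ}, Der (.sub Λ σ Γ) → Der (.ty Λ (A.subst σ))
    | .tm Γ t A => ∀ {Λ σ}, Der (.sub Λ σ Γ) → Der (.tm Λ (t.subst σ) (A.subst σ))
    | .sub Δ γ Γ => ∀ {Λ σ}, Der (.sub Λ σ Δ) → Der (.sub Λ (γ.comp σ) Γ)
    | .cell _ _ _ => True := by
  induction h with
  | ec => trivial
  | ce => trivial
  | obj _ _ => intro Λ σ hσ; exact .obj hσ.ctx_of
  | hom _ _ h1 h2 => intro Λ σ hσ; exact .hom (h1 hσ) (h2 hσ)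
  | var _ hm _ => intro Λ σ hσ; exact hσ.get hm
  | @constr k Γ Δ A γ hc hs _ ih =>
      intro Λ σ hσ
      rw [← A.subst_comp (by rw [hs.sub_dom]; exact hc.vars_cell)]
      exact .constr hc (ih hσ)
  | es _ _ => intro Λ σ hσ; exact .es hσ.ctx_of
  | @se Δ Γ γ x A t hs hA hx _ ih1 _ ih2 =>
      intro Λ σ hσ
      refine .se (ih1 hσ) hA hx ?_
      rw [A.subst_comp (by rw [hs.sub_dom]; exact hA.scoped.1)]
      exact ih2 hσ
  | op => trivial
  | coh => trivial

/-- Derivable judgments are stable under weakening. -/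
theorem Der.weaken {J : Judgment} (h : Der J) :
    match J with
    | .ctx _ => True
    | .ty Γ A => ∀ {Γ'}, Der (.ctx Γ') → (∀ x B, Γ.Mem x B → Γ'.Mem x B) → Der (.ty Γ' A)
    | .tm Γ t A => ∀ {Γ'}, Der (.ctx Γ') → (∀ x B, Γ.Mem x B → Γ'.Mem x B) → Der (.tm Γ' t A)
    | .sub Δ γ Γ => ∀ {Δ'}, Der (.ctx Δ') → (∀ x B, Δ.Mem x B → Δ'.Mem x B) → Der (.sub Δ' γ Γ)
    | .cell _ _ _ => True := by
  induction h with
  | ec => trivial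
  | ce => trivial
  | obj _ _ => intro Γ' h _; exact .obj h
  | hom _ _ h1 h2 => intro Γ' h hm; exact .hom (h1 h hm) (h2 h hm)
  | var _ hx _ => intro Γ' h hm; exact .var h (hm _ _ hx)
  | constr hc hs _ ih => intro Γ' h hm; exact .constr hc (ih h hm)
  | es _ _ => intro Γ' h _; exact .es h
  | se _ hA hx _ ih1 _ ih2 => intro Γ' h hm; exact .se (ih1 h hm) hA hx (ih2 h hm)
  | op => trivial
  | coh => trivial

theorem Der.id : ∀ {Γ : Ctx}, Der (.ctx Γ) → Der (.sub Γ Γ.id Γ)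
  | .nil, h => .es h
  | .cons Γ x A, h => by
      cases h with
      | ce hA hx =>
        refine .se (hA.ctx_of.id.weaken (.ce hA hx) fun _ _ h => .inr h) hA hx ?_
        rw [A.subst_eq_self fun y => Γ.get_id y]
        exact .var (.ce hA hx) (.inl ⟨rfl, rfl⟩)

theorem Der.id_comp {Δ : Ctx} : ∀ {Γ : Ctx} {γ : Sub}, Der (.sub Δ γ Γ) → Γ.id.comp γ = γ
  | .nil, _, h => by cases h; rfl
  | .cons Γ x A, _, h => by
      cases h with
      | @se _ _ γ _ _ t h1 h2 h3 h4 =>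
        have : Γ.id.comp (γ.cons x t) = Γ.id.comp γ := by
          refine Sub.comp_congr _ fun z hz => ?_
          rw [Γ.vars_id] at hz
          have : z ≠ x := fun e => h3 (e ▸ hz)
          simp [Sub.get, this]
        simp [Ctx.id, Sub.comp, this, h1.id_comp, Tm.subst, Sub.get]

/-! ### The syntactic category -/

/-- The objects of the syntactic category of `CaTT`: derivable contexts. -/
structure Syn : Type where
  ctx : Ctx
  der : Der (.ctx ctx)

/-- The morphisms `Δ ⟶ Γ` of the syntactic category of `CaTT`: derivable substitutions
`Δ ⊢ γ : Γ`. -/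
structure Syn.Hom (Δ Γ : Syn) : Type where
  sub : Sub
  der : Der (.sub Δ.ctx sub Γ.ctx)

theorem Syn.Hom.ext {Δ Γ : Syn} {f g : Syn.Hom Δ Γ} (h : f.sub = g.sub) : f = g := by
  cases f; cases g; cases h; rfl

/-- The syntactic category of `CaTT`. -/
instance : Category Syn where
  Hom := Syn.Hom
  id Γ := ⟨Γ.ctx.id, Γ.der.id⟩
  comp δ γ := ⟨γ.sub.comp δ.sub, γ.der.subst δ.der⟩
  id_comp γ := Syn.Hom.ext (Sub.comp_eq_self (fun x => Ctx.get_id x _) γ.sub)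
  comp_id γ := Syn.Hom.ext γ.der.id_comp
  assoc ε δ γ := Syn.Hom.ext
    (Sub.comp_assoc γ.sub (by rw [δ.der.sub_dom]; exact γ.der.scoped.1))

end CaTT

/-! ## The type theory `MCaTT` -/

namespace MCaTT

/-! ### Raw syntax -/

mutual
/-- Raw types: the unit type `𝟙` and `t →_A u`. -/
inductive Ty : Type
  | unit : Ty
  | hom : Ty → Tm → Tm → Ty
/-- Raw terms: variables, the constant `()`, and `mop_{Γ,A}[γ]` and `mcoh_{Γ,A}[γ]`, whose indices
`Γ` and `A` are expressions of `CaTT`. -/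
inductive Tm : Type
  | var : Var → Tm
  | star : Tm
  | constr : Kind → CaTT.Ctx → CaTT.Ty → Sub → Tm
/-- Raw substitutions. -/
inductive Sub : Type
  | nil : Sub
  | cons : Sub → Var → Tm → Sub
end

/-- Raw contexts. -/
inductive Ctx : Type
  | nil : Ctx
  | cons : Ctx → Var → Ty → Ctx

/-- The variables declared by a context. -/
def Ctx.vars : Ctx → Finset Var
  | .nil => ∅
  | .cons Γ x _ => insert x Γ.vars

/-- `Γ.Mem x A` means `(x : A) ∈ Γ`. -/
def Ctx.Mem (x : Var) (A : Ty) : Ctx → Prop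
  | .nil => False
  | .cons Γ y B => (x = y ∧ A = B) ∨ Ctx.Mem x A Γ

/-- The action `x[γ]` of a substitution on a variable. -/
def Sub.get : Sub → Var → Tm
  | .nil, x => .var x
  | .cons γ y t, x => if x = y then t else γ.get x

mutual
/-- `A[σ]` -/
def Ty.subst : Ty → Sub → Ty
  | .unit, _ => .unit
  | .hom A t u, σ => .hom (A.subst σ) (t.subst σ) (u.subst σ)
/-- `t[σ]` -/
def Tm.subst : Tm → Sub → Tm
  | .var x, σ => σ.get x
  | .star, _ => .star
  | .constr k Γ A γ, σ => .constr k Γ A (γ.comp σ)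
/-- `γ.comp σ` is the composite `γ ∘ σ`. -/
def Sub.comp : Sub → Sub → Sub
  | .nil, _ => .nil
  | .cons γ x t, σ => .cons (γ.comp σ) x (t.subst σ)
end

/-- The identity substitution of a context. -/
def Ctx.id : Ctx → Sub
  | .nil => .nil
  | .cons Γ x _ => .cons Γ.id x (.var x)

end MCaTT

/-! ### The desuspension on raw syntax -/

namespace CaTT

mutual
def Ty.desusp : Ty → MCaTT.Ty
  | .obj => .unit
  | .hom A t u => .hom A.desusp t.desusp u.desusp
def Tm.desusp : Tm → MCaTT.Tm
  | .var x => .var x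
  | .constr k Γ A γ => .constr k Γ A γ.desusp
def Sub.desusp : Sub → MCaTT.Sub
  | .nil => .nil
  | .cons γ x t => .cons γ.desusp x t.desusp
end

def Ctx.desusp : Ctx → MCaTT.Ctx
  | .nil => .nil
  | .cons Γ x A => .cons Γ.desusp x A.desusp

end CaTT

namespace MCaTT

/-! ### Judgments and rules -/

/-- The judgments of `MCaTT`: `Γ ⊢`, `Γ ⊢ A`, `Γ ⊢ t : A`, `Δ ⊢ γ : Γ`, and the definitional
equalities `Γ ⊢ A ≡ B`, `Γ ⊢ t ≡ u : A`, `Δ ⊢ γ ≡ δ : Γ`. -/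
inductive Judgment : Type
  | ctx : Ctx → Judgment
  | ty : Ctx → Ty → Judgment
  | tm : Ctx → Tm → Ty → Judgment
  | sub : Ctx → Sub → Ctx → Judgment
  | tyEq : Ctx → Ty → Ty → Judgment
  | tmEq : Ctx → Tm → Tm → Ty → Judgment
  | subEq : Ctx → Sub → Sub → Ctx → Judgment

/-- Derivability in `MCaTT`. Definitional equality is the congruence generated by the rule
`eta`. -/
inductive Der : Judgment → Prop
  | ec : Der (.ctx .nil)
  | ce {Γ : Ctx} {x : Var} {A : Ty} :
      Der (.ty Γ A) → x ∉ Γ.vars → Der (.ctx (.cons Γ x A))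
  | unit {Γ : Ctx} : Der (.ctx Γ) → Der (.ty Γ .unit)
  | hom {Γ : Ctx} {A : Ty} {t u : Tm} :
      Der (.ty Γ A) → Der (.tm Γ t A) → Der (.tm Γ u A) → Der (.ty Γ (.hom A t u))
  | var {Γ : Ctx} {x : Var} {A : Ty} :
      Der (.ctx Γ) → Γ.Mem x A → Der (.tm Γ (.var x) A)
  | star {Γ : Ctx} : Der (.ctx Γ) → Der (.tm Γ .star .unit)
  | constr {k : Kind} {Γ : CaTT.Ctx} {A : CaTT.Ty} {Δ : Ctx} {γ : Sub} :
      CaTT.IsPs Γ → CaTT.Der (.cell k Γ A) → Der (.sub Δ γ Γ.desusp) →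
      Der (.tm Δ (.constr k Γ A γ) (A.desusp.subst γ))
  | conv {Γ : Ctx} {A B : Ty} {t : Tm} :
      Der (.tm Γ t A) → Der (.tyEq Γ A B) → Der (.tm Γ t B)
  | es {Δ : Ctx} : Der (.ctx Δ) → Der (.sub Δ .nil .nil)
  | se {Δ Γ : Ctx} {γ : Sub} {x : Var} {A : Ty} {t : Tm} :
      Der (.sub Δ γ Γ) → Der (.ty Γ A) → x ∉ Γ.vars → Der (.tm Δ t (A.subst γ)) →
      Der (.sub Δ (.cons γ x t) (.cons Γ x A))
  | eta {Γ : Ctx} {t u : Tm} :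
      Der (.tm Γ t .unit) → Der (.tm Γ u .unit) → Der (.tmEq Γ t u .unit)
  | tyRefl {Γ : Ctx} {A : Ty} : Der (.ty Γ A) → Der (.tyEq Γ A A)
  | tySymm {Γ : Ctx} {A B : Ty} : Der (.tyEq Γ A B) → Der (.tyEq Γ B A)
  | tyTrans {Γ : Ctx} {A B C : Ty} :
      Der (.tyEq Γ A B) → Der (.tyEq Γ B C) → Der (.tyEq Γ A C)
  | homCongr {Γ : Ctx} {A A' : Ty} {t t' u u' : Tm} :
      Der (.tyEq Γ A A') → Der (.tmEq Γ t t' A) → Der (.tmEq Γ u u' A) →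
      Der (.tyEq Γ (.hom A t u) (.hom A' t' u'))
  | tmRefl {Γ : Ctx} {t : Tm} {A : Ty} : Der (.tm Γ t A) → Der (.tmEq Γ t t A)
  | tmSymm {Γ : Ctx} {t u : Tm} {A : Ty} : Der (.tmEq Γ t u A) → Der (.tmEq Γ u t A)
  | tmTrans {Γ : Ctx} {t u v : Tm} {A : Ty} :
      Der (.tmEq Γ t u A) → Der (.tmEq Γ u v A) → Der (.tmEq Γ t v A)
  | tmConv {Γ : Ctx} {t u : Tm} {A B : Ty} :
      Der (.tmEq Γ t u A) → Der (.tyEq Γ A B) → Der (.tmEq Γ t u B)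
  | constrCongr {k : Kind} {Γ : CaTT.Ctx} {A : CaTT.Ty} {Δ : Ctx} {γ δ : Sub} :
      CaTT.IsPs Γ → CaTT.Der (.cell k Γ A) → Der (.subEq Δ γ δ Γ.desusp) →
      Der (.tmEq Δ (.constr k Γ A γ) (.constr k Γ A δ) (A.desusp.subst γ))
  | esEq {Δ : Ctx} : Der (.ctx Δ) → Der (.subEq Δ .nil .nil .nil)
  | seEq {Δ Γ : Ctx} {γ δ : Sub} {x : Var} {A : Ty} {t u : Tm} :
      Der (.subEq Δ γ δ Γ) → Der (.ty Γ A) → x ∉ Γ.vars → Der (.tmEq Δ t u (A.subst γ)) →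
      Der (.subEq Δ (.cons γ x t) (.cons δ x u) (.cons Γ x A))

/-- Definitional equality of contexts: the same variables, with definitionally equal types. -/
inductive CtxEq : Ctx → Ctx → Prop
  | nil : CtxEq .nil .nil
  | cons {Γ Γ' : Ctx} {x : Var} {A A' : Ty} :
      CtxEq Γ Γ' → Der (.tyEq Γ A A') → CtxEq (.cons Γ x A) (.cons Γ' x A')

/-! ### The substitution calculus -/

mutual
/-- The variables occurring in a raw type. This is not invariant under definitional equality. -/
def Ty.vars : Ty → Finset Var
  | .unit => ∅
  | .hom A t u => A.vars ∪ t.vars ∪ u.vars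
def Tm.vars : Tm → Finset Var
  | .var x => {x}
  | .star => ∅
  | .constr _ _ _ γ => γ.vars
def Sub.vars : Sub → Finset Var
  | .nil => ∅
  | .cons γ _ t => γ.vars ∪ t.vars
end

/-- The variables to which a substitution assigns a term. -/
def Sub.dom : Sub → Finset Var
  | .nil => ∅
  | .cons γ x _ => insert x γ.dom

mutual
theorem Ty.subst_congr {σ τ : Sub} :
    ∀ A : Ty, (∀ x ∈ A.vars, σ.get x = τ.get x) → A.subst σ = A.subst τ
  | .unit, _ => rfl
  | .hom A t u, h => by
      simp only [Ty.vars, Finset.mem_union] at h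
      simp only [Ty.subst]
      rw [A.subst_congr fun x hx => h x (.inl (.inl hx)),
        t.subst_congr fun x hx => h x (.inl (.inr hx)),
        u.subst_congr fun x hx => h x (.inr hx)]
theorem Tm.subst_congr {σ τ : Sub} :
    ∀ t : Tm, (∀ x ∈ t.vars, σ.get x = τ.get x) → t.subst σ = t.subst τ
  | .var x, h => by simpa [Tm.subst, Tm.vars] using h
  | .star, _ => rfl
  | .constr k Γ A γ, h => by
      simp only [Tm.subst]
      rw [Sub.comp_congr γ (by simpa only [Tm.vars] using h)]
theorem Sub.comp_congr {σ τ : Sub} :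
    ∀ γ : Sub, (∀ x ∈ γ.vars, σ.get x = τ.get x) → γ.comp σ = γ.comp τ
  | .nil, _ => rfl
  | .cons γ x t, h => by
      simp only [Sub.vars, Finset.mem_union] at h
      simp only [Sub.comp]
      rw [Sub.comp_congr γ fun x hx => h x (.inl hx), t.subst_congr fun x hx => h x (.inr hx)]
end

mutual
theorem Ty.subst_eq_self {σ : Sub} (h : ∀ x, σ.get x = .var x) : ∀ A : Ty, A.subst σ = A
  | .unit => rfl
  | .hom A t u => by
      simp only [Ty.subst]
      rw [A.subst_eq_self h, t.subst_eq_self h, u.subst_eq_self h]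
theorem Tm.subst_eq_self {σ : Sub} (h : ∀ x, σ.get x = .var x) : ∀ t : Tm, t.subst σ = t
  | .var x => h x
  | .star => rfl
  | .constr k Γ A γ => by
      simp only [Tm.subst]
      rw [Sub.comp_eq_self h γ]
theorem Sub.comp_eq_self {σ : Sub} (h : ∀ x, σ.get x = .var x) : ∀ γ : Sub, γ.comp σ = γ
  | .nil => rfl
  | .cons γ x t => by
      simp only [Sub.comp]
      rw [Sub.comp_eq_self h γ, t.subst_eq_self h]
end

theorem Sub.get_comp {σ : Sub} {x : Var} :
    ∀ {γ : Sub}, x ∈ γ.dom → (γ.comp σ).get x = (γ.get x).subst σ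
  | .nil, h => by simp [Sub.dom] at h
  | .cons γ y t, h => by
      by_cases hxy : x = y
      · simp [Sub.comp, Sub.get, hxy]
      · have : x ∈ γ.dom := by simpa [Sub.dom, hxy] using h
        simpa [Sub.comp, Sub.get, hxy] using Sub.get_comp this

mutual
theorem Ty.subst_comp {γ σ : Sub} :
    ∀ A : Ty, A.vars ⊆ γ.dom → A.subst (γ.comp σ) = (A.subst γ).subst σ
  | .unit, _ => rfl
  | .hom A t u, h => by
      simp only [Ty.vars, Finset.union_subset_iff] at h
      simp only [Ty.subst]
      rw [A.subst_comp h.1.1, t.subst_comp h.1.2, u.subst_comp h.2]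
theorem Tm.subst_comp {γ σ : Sub} :
    ∀ t : Tm, t.vars ⊆ γ.dom → t.subst (γ.comp σ) = (t.subst γ).subst σ
  | .var x, h => by
      simp only [Tm.vars, Finset.singleton_subset_iff] at h
      simpa only [Tm.subst] using Sub.get_comp h
  | .star, _ => rfl
  | .constr k Γ A δ, h => by
      simp only [Tm.subst]
      rw [Sub.comp_assoc δ (by simpa only [Tm.vars] using h)]
theorem Sub.comp_assoc {γ σ : Sub} :
    ∀ δ : Sub, δ.vars ⊆ γ.dom → δ.comp (γ.comp σ) = (δ.comp γ).comp σ
  | .nil, _ => rfl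
  | .cons δ x t, h => by
      simp only [Sub.vars, Finset.union_subset_iff] at h
      simp only [Sub.comp]
      rw [Sub.comp_assoc δ h.1, t.subst_comp h.2]
end

theorem Ctx.get_id (x : Var) : ∀ Γ : Ctx, Γ.id.get x = .var x
  | .nil => rfl
  | .cons Γ y A => by
      by_cases h : x = y
      · simp [Ctx.id, Sub.get, h]
      · simpa [Ctx.id, Sub.get, h] using Γ.get_id x

theorem Ctx.vars_id : ∀ Γ : Ctx, Γ.id.vars = Γ.vars
  | .nil => rfl
  | .cons Γ y A => by
      have := Γ.vars_id
      simp only [Ctx.id, Sub.vars, Ctx.vars, Tm.vars]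
      grind

theorem Ctx.Mem.mem_vars {x : Var} {A : Ty} : ∀ {Γ : Ctx}, Γ.Mem x A → x ∈ Γ.vars
  | .nil, h => h.elim
  | .cons Γ y B, h => by
      rcases h with ⟨rfl, _⟩ | h
      · simp [Ctx.vars]
      · simp [Ctx.vars, Ctx.Mem.mem_vars h]

mutual
theorem vars_desusp_ty : ∀ A : CaTT.Ty, A.desusp.vars = A.vars
  | .obj => rfl
  | .hom A t u => by
      simp only [CaTT.Ty.desusp, Ty.vars, CaTT.Ty.vars]
      rw [vars_desusp_ty A, vars_desusp_tm t, vars_desusp_tm u]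
theorem vars_desusp_tm : ∀ t : CaTT.Tm, t.desusp.vars = t.vars
  | .var x => rfl
  | .constr k Γ A γ => by
      simp only [CaTT.Tm.desusp, Tm.vars, CaTT.Tm.vars]
      rw [vars_desusp_sub γ]
theorem vars_desusp_sub : ∀ γ : CaTT.Sub, γ.desusp.vars = γ.vars
  | .nil => rfl
  | .cons γ x t => by
      simp only [CaTT.Sub.desusp, Sub.vars, CaTT.Sub.vars]
      rw [vars_desusp_sub γ, vars_desusp_tm t]
end

theorem vars_desusp_ctx : ∀ Γ : CaTT.Ctx, Γ.desusp.vars = Γ.vars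
  | .nil => rfl
  | .cons Γ x A => by simp only [CaTT.Ctx.desusp, Ctx.vars, CaTT.Ctx.vars, vars_desusp_ctx Γ]

theorem Der.sub_dom {Δ : Ctx} : ∀ {Γ : Ctx} {γ : Sub}, Der (.sub Δ γ Γ) → γ.dom = Γ.vars
  | _, .nil, h => by cases h; rfl
  | _, .cons γ x t, h => by
      cases h with
      | se h1 _ _ _ => simp [Sub.dom, Ctx.vars, h1.sub_dom]

theorem Der.subEq_dom {Δ : Ctx} :
    ∀ {Γ : Ctx} {γ δ : Sub}, Der (.subEq Δ γ δ Γ) → γ.dom = Γ.vars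
  | _, .nil, _, h => by cases h; rfl
  | _, .cons γ x t, _, h => by
      cases h with
      | seEq h1 _ _ _ => simp [Sub.dom, Ctx.vars, h1.subEq_dom]

theorem vars_cell {k : Kind} {Γ : CaTT.Ctx} {A : CaTT.Ty} (h : CaTT.Der (.cell k Γ A)) :
    A.desusp.vars ⊆ Γ.desusp.vars := by
  rw [vars_desusp_ty, vars_desusp_ctx]
  exact h.vars_cell

/-- Every derivable judgment has a derivable underlying context. -/
theorem Der.ctx_of {J : Judgment} (h : Der J) :
    match J with
    | .ctx Γ => Der (.ctx Γ)
    | .ty Γ _ => Der (.ctx Γ)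
    | .tm Γ _ _ => Der (.ctx Γ)
    | .sub Δ _ _ => Der (.ctx Δ)
    | .tyEq _ _ _ => True
    | .tmEq _ _ _ _ => True
    | .subEq _ _ _ _ => True := by
  induction h with
  | ec => exact .ec
  | ce h hx _ => exact .ce h hx
  | unit h _ => exact h
  | hom _ _ _ h => exact h
  | var h _ _ => exact h
  | star h => exact h
  | constr _ _ _ h => exact h
  | conv _ _ h => exact h
  | es h _ => exact h
  | se _ _ _ _ h _ _ => exact h
  | _ => trivial

/-- All types declared in a context only use variables of this context. -/
def Ctx.Scoped (Γ : Ctx) : Prop := ∀ x A, Γ.Mem x A → A.vars ⊆ Γ.vars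

/-- The variables of a derivable expression are declared in its context. -/
theorem Der.scoped {J : Judgment} (h : Der J) :
    match J with
    | .ctx Γ => Γ.Scoped
    | .ty Γ A => A.vars ⊆ Γ.vars ∧ Γ.Scoped
    | .tm Γ t _ => t.vars ⊆ Γ.vars
    | .sub Δ γ _ => γ.vars ⊆ Δ.vars
    | .tyEq _ _ _ => True
    | .tmEq _ _ _ _ => True
    | .subEq _ _ _ _ => True := by
  induction h with
  | ec => intro x A h; exact h.elim
  | @ce Γ x A _ hx ih =>
      rintro y B (⟨rfl, rfl⟩ | h)
      · exact ih.1.trans (by simp [Ctx.vars])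
      · exact (ih.2 y B h).trans (by simp [Ctx.vars])
  | unit h ih => exact ⟨by simp [Ty.vars], ih⟩
  | hom _ _ _ h1 h2 h3 =>
      refine ⟨?_, h1.2⟩
      simp only [Ty.vars]
      exact Finset.union_subset (Finset.union_subset h1.1 h2) h3
  | var h hm ih => simpa [Tm.vars] using hm.mem_vars
  | star => simp [Tm.vars]
  | constr _ _ _ ih => simpa [Tm.vars] using ih
  | conv _ _ h => exact h
  | es => simp [Sub.vars]
  | se _ _ _ _ h1 _ h2 =>
      simp only [Sub.vars]
      exact Finset.union_subset h1 h2
  | _ => trivial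

theorem subst_cons {Γ : Ctx} {γ : Sub} {y : Var} {t : Tm} {C : Ty} (hy : y ∉ Γ.vars)
    (hC : C.vars ⊆ Γ.vars) : C.subst (γ.cons y t) = C.subst γ := by
  refine C.subst_congr fun z hz => ?_
  have : z ≠ y := fun e => hy (e ▸ hC hz)
  simp [Sub.get, this]

/-- Substitution acts on the variables of its target. -/
theorem Der.get {Δ : Ctx} {x : Var} {B : Ty} : ∀ {Γ : Ctx} {γ : Sub},
    Der (.sub Δ γ Γ) → Γ.Mem x B → Der (.tm Δ (γ.get x) (B.subst γ))
  | .nil, _, _, hm => hm.elim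
  | .cons Γ y A, _, h, hm => by
      cases h with
      | @se _ _ γ _ _ t h1 h2 h3 h4 =>
        rcases hm with ⟨rfl, rfl⟩ | hm
        · rw [subst_cons h3 h2.scoped.1]
          simpa [Sub.get] using h4
        · have : x ≠ y := fun e => h3 (e ▸ hm.mem_vars)
          rw [subst_cons h3 (h2.scoped.2 _ _ hm)]
          simpa [Sub.get, this] using h1.get hm

theorem Der.getEq {Δ : Ctx} {x : Var} {B : Ty} : ∀ {Γ : Ctx} {γ δ : Sub},
    Der (.subEq Δ γ δ Γ) → Γ.Mem x B → Der (.tmEq Δ (γ.get x) (δ.get x) (B.subst γ))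
  | .nil, _, _, _, hm => hm.elim
  | .cons Γ y A, _, _, h, hm => by
      cases h with
      | @seEq _ _ γ δ _ _ t u h1 h2 h3 h4 =>
        rcases hm with ⟨rfl, rfl⟩ | hm
        · rw [subst_cons h3 h2.scoped.1]
          simpa [Sub.get] using h4
        · have : x ≠ y := fun e => h3 (e ▸ hm.mem_vars)
          rw [subst_cons h3 (h2.scoped.2 _ _ hm)]
          simpa [Sub.get, this] using h1.getEq hm

/-- Derivable judgments are stable under substitution. -/
theorem Der.subst {J : Judgment} (h : Der J) :
    match J with
    | .ctx _ => True
    | .ty Γ A => ∀ {Λ σ}, Der (.sub Λ σ Γ) → Der (.ty Λ (A.subst σ))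
    | .tm Γ t A => ∀ {Λ σ}, Der (.sub Λ σ Γ) → Der (.tm Λ (t.subst σ) (A.subst σ))
    | .sub Δ γ Γ => ∀ {Λ σ}, Der (.sub Λ σ Δ) → Der (.sub Λ (γ.comp σ) Γ)
    | .tyEq Γ A B => ∀ {Λ σ}, Der (.sub Λ σ Γ) → Der (.tyEq Λ (A.subst σ) (B.subst σ))
    | .tmEq Γ t u A => ∀ {Λ σ}, Der (.sub Λ σ Γ) →
        Der (.tmEq Λ (t.subst σ) (u.subst σ) (A.subst σ))
    | .subEq Δ γ δ Γ => ∀ {Λ σ}, Der (.sub Λ σ Δ) → Der (.subEq Λ (γ.comp σ) (δ.comp σ) Γ) := by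
  induction h with
  | ec => trivial
  | ce => trivial
  | unit _ _ => intro Λ σ hσ; exact .unit hσ.ctx_of
  | hom _ _ _ h0 h1 h2 => intro Λ σ hσ; exact .hom (h0 hσ) (h1 hσ) (h2 hσ)
  | var _ hm _ => intro Λ σ hσ; exact hσ.get hm
  | star _ _ => intro Λ σ hσ; exact .star hσ.ctx_of
  | constr hp hc hs ih =>
      intro Λ σ hσ
      rw [← Ty.subst_comp _ (by rw [hs.sub_dom]; exact vars_cell hc)]
      exact .constr hp hc (ih hσ)
  | conv _ _ h1 h2 => intro Λ σ hσ; exact .conv (h1 hσ) (h2 hσ)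
  | es _ _ => intro Λ σ hσ; exact .es hσ.ctx_of
  | se hs hA hx _ ih1 _ ih2 =>
      intro Λ σ hσ
      refine .se (ih1 hσ) hA hx ?_
      rw [Ty.subst_comp _ (by rw [hs.sub_dom]; exact hA.scoped.1)]
      exact ih2 hσ
  | eta _ _ h1 h2 => intro Λ σ hσ; exact .eta (h1 hσ) (h2 hσ)
  | tyRefl _ h => intro Λ σ hσ; exact .tyRefl (h hσ)
  | tySymm _ h => intro Λ σ hσ; exact .tySymm (h hσ)
  | tyTrans _ _ h1 h2 => intro Λ σ hσ; exact .tyTrans (h1 hσ) (h2 hσ)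
  | homCongr _ _ _ h0 h1 h2 => intro Λ σ hσ; exact .homCongr (h0 hσ) (h1 hσ) (h2 hσ)
  | tmRefl _ h => intro Λ σ hσ; exact .tmRefl (h hσ)
  | tmSymm _ h => intro Λ σ hσ; exact .tmSymm (h hσ)
  | tmTrans _ _ h1 h2 => intro Λ σ hσ; exact .tmTrans (h1 hσ) (h2 hσ)
  | tmConv _ _ h1 h2 => intro Λ σ hσ; exact .tmConv (h1 hσ) (h2 hσ)
  | constrCongr hp hc hs ih =>
      intro Λ σ hσ
      rw [← Ty.subst_comp _ (by rw [hs.subEq_dom]; exact vars_cell hc)]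
      exact .constrCongr hp hc (ih hσ)
  | esEq _ _ => intro Λ σ hσ; exact .esEq hσ.ctx_of
  | seEq hs hA hx _ ih1 _ ih2 =>
      intro Λ σ hσ
      refine .seEq (ih1 hσ) hA hx ?_
      rw [Ty.subst_comp _ (by rw [hs.subEq_dom]; exact hA.scoped.1)]
      exact ih2 hσ

/-- Derivable judgments are stable under weakening. -/
theorem Der.weaken {J : Judgment} (h : Der J) :
    match J with
    | .ctx _ => True
    | .ty Γ A => ∀ {Γ'}, Der (.ctx Γ') → (∀ x B, Γ.Mem x B → Γ'.Mem x B) → Der (.ty Γ' A)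
    | .tm Γ t A => ∀ {Γ'}, Der (.ctx Γ') → (∀ x B, Γ.Mem x B → Γ'.Mem x B) → Der (.tm Γ' t A)
    | .sub Δ γ Γ => ∀ {Δ'}, Der (.ctx Δ') → (∀ x B, Δ.Mem x B → Δ'.Mem x B) → Der (.sub Δ' γ Γ)
    | .tyEq Γ A B => ∀ {Γ'}, Der (.ctx Γ') → (∀ x B, Γ.Mem x B → Γ'.Mem x B) →
        Der (.tyEq Γ' A B)
    | .tmEq Γ t u A => ∀ {Γ'}, Der (.ctx Γ') → (∀ x B, Γ.Mem x B → Γ'.Mem x B) →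
        Der (.tmEq Γ' t u A)
    | .subEq Δ γ δ Γ => ∀ {Δ'}, Der (.ctx Δ') → (∀ x B, Δ.Mem x B → Δ'.Mem x B) →
        Der (.subEq Δ' γ δ Γ) := by
  induction h with
  | ec => trivial
  | ce => trivial
  | unit _ _ => intro Γ' h _; exact .unit h
  | hom _ _ _ h0 h1 h2 => intro Γ' h hm; exact .hom (h0 h hm) (h1 h hm) (h2 h hm)
  | var _ hx _ => intro Γ' h hm; exact .var h (hm _ _ hx)
  | star _ _ => intro Γ' h _; exact .star h
  | constr hp hc hs ih => intro Γ' h hm; exact .constr hp hc (ih h hm)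
  | conv _ _ h1 h2 => intro Γ' h hm; exact .conv (h1 h hm) (h2 h hm)
  | es _ _ => intro Γ' h _; exact .es h
  | se _ hA hx _ ih1 _ ih2 => intro Γ' h hm; exact .se (ih1 h hm) hA hx (ih2 h hm)
  | eta _ _ h1 h2 => intro Γ' h hm; exact .eta (h1 h hm) (h2 h hm)
  | tyRefl _ h1 => intro Γ' h hm; exact .tyRefl (h1 h hm)
  | tySymm _ h1 => intro Γ' h hm; exact .tySymm (h1 h hm)
  | tyTrans _ _ h1 h2 => intro Γ' h hm; exact .tyTrans (h1 h hm) (h2 h hm)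
  | homCongr _ _ _ h0 h1 h2 =>
      intro Γ' h hm; exact .homCongr (h0 h hm) (h1 h hm) (h2 h hm)
  | tmRefl _ h1 => intro Γ' h hm; exact .tmRefl (h1 h hm)
  | tmSymm _ h1 => intro Γ' h hm; exact .tmSymm (h1 h hm)
  | tmTrans _ _ h1 h2 => intro Γ' h hm; exact .tmTrans (h1 h hm) (h2 h hm)
  | tmConv _ _ h1 h2 => intro Γ' h hm; exact .tmConv (h1 h hm) (h2 h hm)
  | constrCongr hp hc hs ih => intro Γ' h hm; exact .constrCongr hp hc (ih h hm)
  | esEq _ _ => intro Γ' h _; exact .esEq h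
  | seEq _ hA hx _ ih1 _ ih2 => intro Γ' h hm; exact .seEq (ih1 h hm) hA hx (ih2 h hm)

theorem Der.id : ∀ {Γ : Ctx}, Der (.ctx Γ) → Der (.sub Γ Γ.id Γ)
  | .nil, h => .es h
  | .cons Γ x A, h => by
      cases h with
      | ce hA hx =>
        refine .se (hA.ctx_of.id.weaken (.ce hA hx) fun _ _ h => .inr h) hA hx ?_
        rw [A.subst_eq_self fun y => Γ.get_id y]
        exact .var (.ce hA hx) (.inl ⟨rfl, rfl⟩)

theorem Der.id_comp {Δ : Ctx} : ∀ {Γ : Ctx} {γ : Sub}, Der (.sub Δ γ Γ) → Γ.id.comp γ = γ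
  | .nil, _, h => by cases h; rfl
  | .cons Γ x A, _, h => by
      cases h with
      | @se _ _ γ _ _ t h1 h2 h3 h4 =>
        have : Γ.id.comp (γ.cons x t) = Γ.id.comp γ := by
          refine Sub.comp_congr _ fun z hz => ?_
          rw [Γ.vars_id] at hz
          have : z ≠ x := fun e => h3 (e ▸ hz)
          simp [Sub.get, this]
        simp [Ctx.id, Sub.comp, this, h1.id_comp, Tm.subst, Sub.get]

/-- Substitution respects the definitional equality of substitutions. -/
theorem Der.functional {J : Judgment} (h : Der J) :
    match J with
    | .ty Γ A => ∀ {Λ σ τ}, Der (.sub Λ σ Γ) → Der (.subEq Λ σ τ Γ) →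
        Der (.tyEq Λ (A.subst σ) (A.subst τ))
    | .tm Γ t A => ∀ {Λ σ τ}, Der (.sub Λ σ Γ) → Der (.subEq Λ σ τ Γ) →
        Der (.tmEq Λ (t.subst σ) (t.subst τ) (A.subst σ))
    | .sub Δ γ Γ => ∀ {Λ σ τ}, Der (.sub Λ σ Δ) → Der (.subEq Λ σ τ Δ) →
        Der (.subEq Λ (γ.comp σ) (γ.comp τ) Γ)
    | _ => True := by
  induction h with
  | unit _ _ => intro Λ σ τ hσ _; exact .tyRefl (.unit hσ.ctx_of)
  | hom _ _ _ h0 h1 h2 =>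
      intro Λ σ τ hσ e; exact .homCongr (h0 hσ e) (h1 hσ e) (h2 hσ e)
  | var _ hm _ => intro Λ σ τ _ e; exact e.getEq hm
  | star _ _ => intro Λ σ τ hσ _; exact .tmRefl (.star hσ.ctx_of)
  | constr hp hc hs ih =>
      intro Λ σ τ hσ e
      rw [← Ty.subst_comp _ (by rw [hs.sub_dom]; exact vars_cell hc)]
      exact .constrCongr hp hc (ih hσ e)
  | conv _ hB h1 _ => intro Λ σ τ hσ e; exact .tmConv (h1 hσ e) (hB.subst hσ)
  | es _ _ => intro Λ σ τ hσ _; exact .esEq hσ.ctx_of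
  | se hs hA hx _ ih1 _ ih2 =>
      intro Λ σ τ hσ e
      refine .seEq (ih1 hσ e) hA hx ?_
      rw [Ty.subst_comp _ (by rw [hs.sub_dom]; exact hA.scoped.1)]
      exact ih2 hσ e
  | _ => trivial

theorem Der.subEq_refl {Δ : Ctx} :
    ∀ {Γ : Ctx} {γ : Sub}, Der (.sub Δ γ Γ) → Der (.subEq Δ γ γ Γ)
  | _, .nil, h => by cases h with | es h => exact .esEq h
  | _, .cons γ x t, h => by
      cases h with
      | se h1 h2 h3 h4 => exact .seEq h1.subEq_refl h2 h3 (.tmRefl h4)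

theorem Der.subEq_symm {Δ : Ctx} : ∀ {Γ : Ctx} {γ δ : Sub},
    Der (.sub Δ γ Γ) → Der (.subEq Δ γ δ Γ) → Der (.subEq Δ δ γ Γ)
  | _, .nil, _, _, h => by cases h with | esEq h => exact .esEq h
  | _, .cons γ x t, _, h, h' => by
      cases h' with
      | seEq e1 e2 e3 e4 =>
        cases h with
        | se h1 h2 h3 h4 =>
          exact .seEq (h1.subEq_symm e1) e2 e3 (.tmConv (.tmSymm e4) (e2.functional h1 e1))

theorem Der.subEq_trans {Δ : Ctx} : ∀ {Γ : Ctx} {γ δ ε : Sub},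
    Der (.sub Δ γ Γ) → Der (.subEq Δ γ δ Γ) → Der (.subEq Δ δ ε Γ) → Der (.subEq Δ γ ε Γ)
  | _, .nil, _, _, _, h, h' => by cases h; exact h'
  | _, .cons γ x t, _, _, h, h', h'' => by
      cases h' with
      | seEq e1 e2 e3 e4 =>
        cases h with
        | se h1 h2 h3 h4 =>
          cases h'' with
          | seEq f1 f2 f3 f4 =>
            exact .seEq (h1.subEq_trans e1 f1) e2 e3
              (.tmTrans e4 (.tmConv f4 (.tySymm (e2.functional h1 e1))))

theorem Der.ty_mem {x : Var} {A : Ty} : ∀ {Γ : Ctx},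
    Der (.ctx Γ) → Γ.Mem x A → Der (.ty Γ A)
  | .nil, _, hm => hm.elim
  | .cons Γ y B, h, hm => by
      have h' := h
      cases h' with
      | ce hB _ =>
        rcases hm with ⟨_, rfl⟩ | hm
        · exact hB.weaken h fun _ _ h => .inr h
        · exact (hB.ctx_of.ty_mem hm).weaken h fun _ _ h => .inr h

/-! ### Definitionally equal contexts -/

theorem CtxEq.id_eq {Γ Γ' : Ctx} (h : CtxEq Γ Γ') : Γ.id = Γ'.id := by
  induction h with
  | nil => rfl
  | cons _ _ ih => simp only [Ctx.id, ih]

/-- Over definitionally equal contexts, the identity substitution is a substitution from the one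
to the other. -/
theorem CtxEq.sub {Γ Γ' : Ctx} (h : CtxEq Γ Γ') :
    Der (.ctx Γ) → Der (.ctx Γ') → Der (.sub Γ' Γ.id Γ) := by
  induction h with
  | nil => intro h _; exact .es h
  | @cons Γ Γ' x A A' _ e ih =>
      intro h h'
      cases h with
      | ce hA hx =>
        have h'' := h'
        cases h'' with
        | ce hA' hx' =>
          have hs := ih hA.ctx_of hA'.ctx_of
          have hw := hs.weaken h' fun _ _ h => .inr h
          refine .se hw hA hx (.conv (.var h' (.inl ⟨rfl, rfl⟩)) ?_)
          have := Der.tySymm (e.subst hw)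
          rwa [A'.subst_eq_self fun y => Γ.get_id y] at this

theorem CtxEq.refl : ∀ {Γ : Ctx}, Der (.ctx Γ) → CtxEq Γ Γ
  | .nil, _ => .nil
  | .cons Γ x A, h => by
      cases h with
      | ce hA _ => exact .cons (CtxEq.refl hA.ctx_of) (.tyRefl hA)

theorem CtxEq.symm {Γ Γ' : Ctx} (h : CtxEq Γ Γ') :
    Der (.ctx Γ) → Der (.ctx Γ') → CtxEq Γ' Γ := by
  induction h with
  | nil => intro _ _; exact .nil
  | @cons Γ Γ' x A A' hc e ih =>
      intro h h'
      cases h with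
      | ce hA hx =>
        cases h' with
        | ce hA' hx' =>
          have := Der.tySymm (e.subst (hc.sub hA.ctx_of hA'.ctx_of))
          rw [A'.subst_eq_self fun y => Γ.get_id y, A.subst_eq_self fun y => Γ.get_id y] at this
          exact .cons (ih hA.ctx_of hA'.ctx_of) this

theorem CtxEq.trans : ∀ {Γ Γ' Γ'' : Ctx}, CtxEq Γ Γ' → CtxEq Γ' Γ'' →
    Der (.ctx Γ) → Der (.ctx Γ') → CtxEq Γ Γ''
  | _, _, _, .nil, h, _, _ => h
  | _, _, _, @CtxEq.cons Γ Γ' x A A' hc e, h, hΓ, hΓ' => by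
      cases h with
      | cons hc' e' =>
        cases hΓ with
        | ce hA hx =>
          cases hΓ' with
          | ce hA' hx' =>
            have := e'.subst ((hc.symm hA.ctx_of hA'.ctx_of).sub hA'.ctx_of hA.ctx_of)
            rw [Ty.subst_eq_self fun y => Γ'.get_id y, Ty.subst_eq_self fun y => Γ'.get_id y]
              at this
            exact .cons (hc.trans hc' hA.ctx_of hA'.ctx_of) (.tyTrans e this)

/-! ### The syntactic category -/

/-- Derivable contexts. -/
structure VCtx : Type where
  ctx : Ctx
  der : Der (.ctx ctx)

instance VCtx.setoid : Setoid VCtx where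
  r Γ Γ' := CtxEq Γ.ctx Γ'.ctx
  iseqv :=
    ⟨fun Γ => .refl Γ.der, fun {Γ Γ'} h => h.symm Γ.der Γ'.der,
      fun {Γ Γ' _} h h' => h.trans h' Γ.der Γ'.der⟩

theorem Der.sub_congr {Δ Δ' Γ Γ' : VCtx} (hΔ : Δ ≈ Δ') (hΓ : Γ ≈ Γ') {γ : Sub}
    (h : Der (.sub Δ.ctx γ Γ.ctx)) : Der (.sub Δ'.ctx γ Γ'.ctx) := by
  have h1 := h.subst (CtxEq.sub hΔ Δ.der Δ'.der)
  rw [Sub.comp_eq_self fun y => Δ.ctx.get_id y] at h1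
  have h2 := (CtxEq.sub (Setoid.symm hΓ) Γ'.der Γ.der).subst h1
  rwa [← CtxEq.id_eq hΓ, h1.id_comp] at h2

theorem Der.subEq_congr {Δ Δ' Γ Γ' : VCtx} (hΔ : Δ ≈ Δ') (hΓ : Γ ≈ Γ') {γ δ : Sub}
    (hγ : Der (.sub Δ.ctx γ Γ.ctx)) (hδ : Der (.sub Δ.ctx δ Γ.ctx))
    (h : Der (.subEq Δ.ctx γ δ Γ.ctx)) : Der (.subEq Δ'.ctx γ δ Γ'.ctx) := by
  have h1 := h.subst (CtxEq.sub hΔ Δ.der Δ'.der)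
  rw [Sub.comp_eq_self fun y => Δ.ctx.get_id y, Sub.comp_eq_self fun y => Δ.ctx.get_id y] at h1
  have hγ' := hγ.sub_congr hΔ (Setoid.refl Γ)
  have hδ' := hδ.sub_congr hΔ (Setoid.refl Γ)
  have h2 := (CtxEq.sub (Setoid.symm hΓ) Γ'.der Γ.der).functional hγ' h1
  rwa [← CtxEq.id_eq hΓ, hγ'.id_comp, hδ'.id_comp] at h2

/-- The objects of the syntactic category of `MCaTT`: derivable contexts up to definitional
equality. -/
def Syn : Type := Quotient VCtx.setoid

/-- The object given by a derivable context. -/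
def Syn.mk (Γ : VCtx) : Syn := Quotient.mk VCtx.setoid Γ

/-- `Syn.PreHom X Y` consists of the substitutions that are derivable from `X` to `Y`, that is, from a
context representing `X` to a context representing `Y` (the choice does not matter). -/
structure Syn.PreHom (X Y : Syn) : Type where
  sub : Sub
  der : ∃ Δ Γ : VCtx, Syn.mk Δ = X ∧ Syn.mk Γ = Y ∧ Der (.sub Δ.ctx sub Γ.ctx)

theorem Syn.PreHom.der' {Δ Γ : VCtx} (f : Syn.PreHom (Syn.mk Δ) (Syn.mk Γ)) :
    Der (.sub Δ.ctx f.sub Γ.ctx) := by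
  obtain ⟨Δ', Γ', h1, h2, h⟩ := f.der
  exact h.sub_congr (Quotient.exact h1) (Quotient.exact h2)

theorem Syn.PreHom.eq_iff {Δ Γ : VCtx} (f g : Syn.PreHom (Syn.mk Δ) (Syn.mk Γ)) :
    (∃ Δ' Γ' : VCtx, Syn.mk Δ' = Syn.mk Δ ∧ Syn.mk Γ' = Syn.mk Γ ∧
      Der (.subEq Δ'.ctx f.sub g.sub Γ'.ctx)) ↔ Der (.subEq Δ.ctx f.sub g.sub Γ.ctx) := by
  refine ⟨?_, fun h => ⟨Δ, Γ, rfl, rfl, h⟩⟩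
  rintro ⟨Δ', Γ', h1, h2, h⟩
  have e1 := Quotient.exact h1
  have e2 := Quotient.exact h2
  exact Der.subEq_congr e1 e2 (f.der'.sub_congr (Setoid.symm e1) (Setoid.symm e2))
    (g.der'.sub_congr (Setoid.symm e1) (Setoid.symm e2)) h

/-- Definitional equality of substitutions. -/
instance Syn.PreHom.setoid (X Y : Syn) : Setoid (Syn.PreHom X Y) where
  r f g := ∃ Δ Γ : VCtx, Syn.mk Δ = X ∧ Syn.mk Γ = Y ∧ Der (.subEq Δ.ctx f.sub g.sub Γ.ctx)
  iseqv := by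
    induction X using Quotient.ind
    induction Y using Quotient.ind
    refine ⟨fun f => ?_, fun {f g} h => ?_, fun {f g k} h h' => ?_⟩
    · exact (Syn.PreHom.eq_iff f f).2 f.der'.subEq_refl
    · exact (Syn.PreHom.eq_iff g f).2 (f.der'.subEq_symm ((Syn.PreHom.eq_iff f g).1 h))
    · exact (Syn.PreHom.eq_iff f k).2
        (f.der'.subEq_trans ((Syn.PreHom.eq_iff f g).1 h) ((Syn.PreHom.eq_iff g k).1 h'))

def Syn.PreHom.id (X : Syn) : Syn.PreHom X X where
  sub := Quotient.lift (fun Γ : VCtx => Γ.ctx.id) (fun _ _ h => CtxEq.id_eq h) X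
  der := by
    induction X using Quotient.ind with
    | _ Γ => exact ⟨Γ, Γ, rfl, rfl, Γ.der.id⟩

def Syn.PreHom.comp {X Y Z : Syn} (f : Syn.PreHom X Y) (g : Syn.PreHom Y Z) :
    Syn.PreHom X Z where
  sub := g.sub.comp f.sub
  der := by
    induction X using Quotient.ind with
    | _ Δ => induction Y using Quotient.ind with
      | _ Γ => induction Z using Quotient.ind with
        | _ Θ => exact ⟨Δ, Θ, rfl, rfl, Der.subst (PreHom.der' g) (PreHom.der' f)⟩

/-- The morphisms of the syntactic category of `MCaTT`: derivable substitutions up to definitional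
equality. -/
def Syn.Hom (X Y : Syn) : Type := Quotient (Syn.PreHom.setoid X Y)

theorem Syn.PreHom.comp_congr {X Y Z : Syn} (f f' : Syn.PreHom X Y) (g g' : Syn.PreHom Y Z)
    (hf : f ≈ f') (hg : g ≈ g') : f.comp g ≈ f'.comp g' := by
  induction X using Quotient.ind with
  | _ Δ => induction Y using Quotient.ind with
    | _ Γ => induction Z using Quotient.ind with
      | _ Θ =>
        have hf := (Syn.PreHom.eq_iff f f').1 hf
        have hg := (Syn.PreHom.eq_iff g g').1 hg
        have h1 := hg.subst (PreHom.der' f)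
        have h2 := Der.functional (PreHom.der' g') (PreHom.der' f) hf
        have h0 := Der.subst (PreHom.der' g) (PreHom.der' f)
        exact (Syn.PreHom.eq_iff (f.comp g) (f'.comp g')).2 (h0.subEq_trans h1 h2)

theorem Syn.PreHom.ext {X Y : Syn} {f g : Syn.PreHom X Y} (h : f.sub = g.sub) : f = g := by
  cases f; cases g; cases h; rfl

/-- The syntactic category of `MCaTT`. -/
instance : Category Syn where
  Hom := Syn.Hom
  id X := Quotient.mk _ (Syn.PreHom.id X)
  comp {X Y Z} f g := Quotient.map₂ (sa := Syn.PreHom.setoid X Y) (sb := Syn.PreHom.setoid Y Z)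
    (sc := Syn.PreHom.setoid X Z) Syn.PreHom.comp
    (fun f f' hf g g' hg => Syn.PreHom.comp_congr f f' g g' hf hg) f g
  id_comp {X Y} f := by
    induction X using Quotient.ind with
    | _ Δ => induction f using Quotient.ind with
      | _ f =>
        refine congrArg (Quotient.mk _) (Syn.PreHom.ext ?_)
        exact Sub.comp_eq_self (fun y => Δ.ctx.get_id y) f.sub
  comp_id {X Y} f := by
    induction X using Quotient.ind with
    | _ Δ => induction Y using Quotient.ind with
      | _ Γ => induction f using Quotient.ind with
        | _ f => exact congrArg (Quotient.mk _) (Syn.PreHom.ext (Syn.PreHom.der' f).id_comp)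
  assoc {W X Y Z} f g h := by
    induction X using Quotient.ind with
    | _ Δ => induction Y using Quotient.ind with
      | _ Γ => induction Z using Quotient.ind with
        | _ Θ => induction f using Quotient.ind with
          | _ f => induction g using Quotient.ind with
            | _ g => induction h using Quotient.ind with
              | _ h =>
                refine congrArg (Quotient.mk _) (Syn.PreHom.ext ?_)
                exact Sub.comp_assoc _ (by
                  rw [(Syn.PreHom.der' g).sub_dom]; exact (Syn.PreHom.der' h).scoped)

/-- The morphism given by a derivable substitution. -/
def Syn.homMk {Δ Γ : VCtx} (γ : Sub) (h : Der (.sub Δ.ctx γ Γ.ctx)) : Syn.mk Δ ⟶ Syn.mk Γ :=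
  Quotient.mk (Syn.PreHom.setoid _ _) ⟨γ, Δ, Γ, rfl, rfl, h⟩

end MCaTT

/-! ## The desuspension functor -/

namespace CaTT

theorem Der.tgt_of {Δ : Ctx} : ∀ {Γ : Ctx} {γ : Sub}, Der (.sub Δ γ Γ) → Der (.ctx Γ)
  | .nil, _, _ => .ec
  | .cons Γ x A, _, h => by
      cases h with
      | se _ h2 h3 _ => exact .ce h2 h3

theorem mem_srcAt {x : Var} {B : Ty} (i : ℕ) : ∀ Γ : Ctx, (Γ.srcAt i).Mem x B → Γ.Mem x B
  | .cons (.cons Γ y A) f C, h => by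
      have := mem_srcAt (x := x) (B := B) i Γ
      rw [Ctx.srcAt] at h
      split_ifs at h <;> simp only [Ctx.Mem] at h ⊢ <;> tauto
  | .cons .nil x A, h => by simpa [Ctx.srcAt] using h
  | .nil, h => by simpa [Ctx.srcAt] using h

theorem mem_drop {x : Var} {B : Ty} (Γ : Ctx) : Γ.drop.Mem x B → Γ.Mem x B := by
  cases Γ with
  | nil => exact fun h => h
  | cons Γ y A => exact fun h => .inr h

theorem mem_tgtAt {x : Var} {B : Ty} (i : ℕ) : ∀ Γ : Ctx, (Γ.tgtAt i).Mem x B → Γ.Mem x B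
  | .cons (.cons Γ y A) f C, h => by
      have := mem_tgtAt (x := x) (B := B) i Γ
      have := mem_drop (x := x) (B := B) (Γ.tgtAt i)
      rw [Ctx.tgtAt] at h
      split_ifs at h <;> simp only [Ctx.Mem] at h ⊢ <;> tauto
  | .cons .nil x A, h => by simpa [Ctx.tgtAt] using h
  | .nil, h => by simpa [Ctx.tgtAt] using h

theorem Der.ty_mem {x : Var} {A : Ty} : ∀ {Γ : Ctx}, Der (.ctx Γ) → Γ.Mem x A → Der (.ty Γ A)
  | .nil, _, hm => hm.elim
  | .cons Γ y B, h, hm => by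
      have h' := h
      cases h' with
      | ce hB _ =>
        rcases hm with ⟨_, rfl⟩ | hm
        · exact hB.weaken h fun _ _ h => .inr h
        · exact (hB.ctx_of.ty_mem hm).weaken h fun _ _ h => .inr h

/-- Ps-contexts are derivable contexts. -/
theorem Ps.ctx_mem {Γ : Ctx} {x : Var} {A : Ty} (h : Ps Γ x A) :
    Der (.ctx Γ) ∧ Γ.Mem x A := by
  induction h with
  | pss x => exact ⟨.ce (.obj .ec) (by simp [Ctx.vars]), .inl ⟨rfl, rfl⟩⟩
  | psd _ ih =>
      refine ⟨ih.1, ?_⟩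
      cases ih.1.ty_mem ih.2 with
      | hom _ h => cases h with | var _ h => exact h
  | @pse Γ x y f A _ hy hf hfy ih =>
      have h1 : Der (.ctx (Γ.cons y A)) := .ce (ih.1.ty_mem ih.2) hy
      exact ⟨.ce (.hom (.var h1 (.inr ih.2)) (.var h1 (.inl ⟨rfl, rfl⟩)))
        (by simp [Ctx.vars, hf, hfy]), .inl ⟨rfl, rfl⟩⟩

theorem IsPs.ctx {Γ : Ctx} (h : IsPs Γ) : Der (.ctx Γ) := h.elim fun _ h => h.ctx_mem.1

theorem Sub.desusp_get (x : Var) : ∀ γ : Sub, (γ.get x).desusp = γ.desusp.get x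
  | .nil => rfl
  | .cons γ y t => by
      by_cases h : x = y
      · simp [Sub.get, Sub.desusp, MCaTT.Sub.get, h]
      · simpa [Sub.get, Sub.desusp, MCaTT.Sub.get, h] using γ.desusp_get x

mutual
theorem Ty.desusp_subst (σ : Sub) : ∀ A : Ty, (A.subst σ).desusp = A.desusp.subst σ.desusp
  | .obj => rfl
  | .hom A t u => by
      simp only [Ty.subst, Ty.desusp, MCaTT.Ty.subst]
      rw [A.desusp_subst σ, t.desusp_subst σ, u.desusp_subst σ]
theorem Tm.desusp_subst (σ : Sub) : ∀ t : Tm, (t.subst σ).desusp = t.desusp.subst σ.desusp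
  | .var x => Sub.desusp_get x σ
  | .constr k Γ A γ => by
      simp only [Tm.subst, Tm.desusp, MCaTT.Tm.subst]
      rw [Sub.desusp_comp σ γ]
theorem Sub.desusp_comp (σ : Sub) : ∀ γ : Sub, (γ.comp σ).desusp = γ.desusp.comp σ.desusp
  | .nil => rfl
  | .cons γ x t => by
      simp only [Sub.comp, Sub.desusp, MCaTT.Sub.comp]
      rw [Sub.desusp_comp σ γ, t.desusp_subst σ]
end

theorem Ctx.desusp_id : ∀ Γ : Ctx, Γ.id.desusp = Γ.desusp.id
  | .nil => rfl
  | .cons Γ x A => by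
      simp only [Ctx.id, Sub.desusp, Ctx.desusp, MCaTT.Ctx.id, Γ.desusp_id, Tm.desusp]

theorem Ctx.mem_desusp {x : Var} {B : MCaTT.Ty} :
    ∀ {Γ : Ctx}, Γ.desusp.Mem x B ↔ ∃ A, Γ.Mem x A ∧ B = A.desusp
  | .nil => by simp [Ctx.desusp, Ctx.Mem, MCaTT.Ctx.Mem]
  | .cons Γ y C => by
      simp only [Ctx.desusp, Ctx.Mem, MCaTT.Ctx.Mem, Ctx.mem_desusp (Γ := Γ)]
      constructor
      · rintro (⟨rfl, rfl⟩ | ⟨A, h, rfl⟩)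
        · exact ⟨C, .inl ⟨rfl, rfl⟩, rfl⟩
        · exact ⟨A, .inr h, rfl⟩
      · rintro ⟨A, ⟨rfl, rfl⟩ | h, rfl⟩
        · exact .inl ⟨rfl, rfl⟩
        · exact .inr ⟨A, h, rfl⟩

theorem Ctx.desusp_mono {Γ Γ' : Ctx} (h : ∀ x B, Γ.Mem x B → Γ'.Mem x B) :
    ∀ x B, Γ.desusp.Mem x B → Γ'.desusp.Mem x B := by
  intro x B hm
  obtain ⟨A, hA, rfl⟩ := Ctx.mem_desusp.1 hm
  exact Ctx.mem_desusp.2 ⟨A, h _ _ hA, rfl⟩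

theorem Der.isPs {k : Kind} {Γ : Ctx} {A : Ty} (h : Der (.cell k Γ A)) : IsPs Γ := by
  cases h <;> assumption

/-- The desuspension preserves derivability. -/
theorem Der.desusp {J : Judgment} (h : Der J) :
    match J with
    | .ctx Γ => MCaTT.Der (.ctx Γ.desusp)
    | .ty Γ A => MCaTT.Der (.ty Γ.desusp A.desusp)
    | .tm Γ t A => MCaTT.Der (.tm Γ.desusp t.desusp A.desusp) ∧
        MCaTT.Der (.ty Γ.desusp A.desusp)
    | .sub Δ γ Γ => MCaTT.Der (.sub Δ.desusp γ.desusp Γ.desusp) ∧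
        MCaTT.Der (.ctx Γ.desusp)
    | .cell _ Γ A => MCaTT.Der (.ctx Γ.desusp) → MCaTT.Der (.ty Γ.desusp A.desusp) := by
  induction h with
  | ec => exact .ec
  | ce _ hx ih => exact .ce ih (by rwa [MCaTT.vars_desusp_ctx])
  | obj _ ih => exact .unit ih
  | hom _ _ h1 h2 => exact .hom h1.2 h1.1 h2.1
  | var _ hm ih =>
      have := Ctx.mem_desusp.2 ⟨_, hm, rfl⟩
      exact ⟨.var ih this, ih.ty_mem this⟩
  | constr hc _ ih1 ih2 =>
      refine ⟨?_, ?_⟩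
      · rw [Ty.desusp_subst]
        exact .constr hc.isPs hc ih2.1
      · rw [Ty.desusp_subst]
        exact (ih1 ih2.2).subst ih2.1
  | es _ ih => exact ⟨.es ih, .ec⟩
  | @se Δ Γ γ x A t _ _ hx _ h1 hA h2 =>
      have hx' : x ∉ Γ.desusp.vars := by rwa [MCaTT.vars_desusp_ctx]
      exact ⟨.se h1.1 hA hx' (by rw [← Ty.desusp_subst]; exact h2.1), .ce hA hx'⟩
  | @op Γ A t u _ _ _ _ _ _ h1 h2 =>
      intro h
      have hs := Ctx.desusp_mono (Γ := Γ.src) (Γ' := Γ) fun _ _ => mem_srcAt _ _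
      have ht := Ctx.desusp_mono (Γ := Γ.tgt) (Γ' := Γ) fun _ _ => mem_tgtAt _ _
      exact .hom (h1.2.weaken h hs) (h1.1.weaken h hs) (h2.1.weaken h ht)
  | coh _ _ _ _ _ h1 h2 => intro _; exact .hom h1.2 h1.1 h2.1

/-- The desuspension functor. -/
def desuspension : Syn ⥤ MCaTT.Syn where
  obj Γ := MCaTT.Syn.mk ⟨Γ.ctx.desusp, Γ.der.desusp⟩
  map γ := MCaTT.Syn.homMk γ.sub.desusp γ.der.desusp.1
  map_id Γ := congrArg (Quotient.mk _) (MCaTT.Syn.PreHom.ext (Ctx.desusp_id Γ.ctx))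
  map_comp δ γ := congrArg (Quotient.mk _) (MCaTT.Syn.PreHom.ext (Sub.desusp_comp δ.sub γ.sub))

end CaTT

/-! ## The reduced suspension on raw syntax

The reduced suspension of a context `Γ` of `MCaTT` declares one additional variable `• : ⋆`, whose
name has to differ from those of the variables of `Γ` that are kept, that is, of the variables whose
type is not `𝟙`. To this end we fix a function `new` that chooses a variable `new s ∉ s` for every
finite set `s` of variables. The reduced suspension of an expression over `Γ` depends on the name of
`•` for `Γ`, and on which variables have type `𝟙` in `Γ`, as those are the variables that are not in
normal form (they are definitionally equal to `()`). -/

namespace MCaTT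

/-- The variables declared with type `𝟙`. -/
def Ctx.unitVars : Ctx → Finset Var
  | .nil => ∅
  | .cons Γ x .unit => insert x Γ.unitVars
  | .cons Γ _ (.hom _ _ _) => Γ.unitVars

/-- The variables declared with a type other than `𝟙`. -/
def Ctx.nonUnitVars : Ctx → Finset Var
  | .nil => ∅
  | .cons Γ _ .unit => Γ.nonUnitVars
  | .cons Γ x (.hom _ _ _) => insert x Γ.nonUnitVars

/-- The data on a context needed to define the reduced suspension of the expressions over it: the
variables of type `𝟙`, and the name of the variable `•`. -/
structure Frame : Type where
  units : Finset Var
  pt : Var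

/-- The frame of a context. -/
def Ctx.frame (new : Finset Var → Var) (Γ : Ctx) : Frame := ⟨Γ.unitVars, new Γ.nonUnitVars⟩

/-- The reduced suspension of a variable: `•` if its type is `𝟙`, and itself otherwise. -/
def Frame.susVar (F : Frame) (x : Var) : Var := if x ∈ F.units then F.pt else x

/-- The assignment `x ↦ ↑↓x` for all the variables `x` of a context of `CaTT`. -/
def Frame.bullet (F : Frame) : CaTT.Ctx → CaTT.Sub
  | .nil => .nil
  | .cons Γ x _ => .cons (F.bullet Γ) x (.var (F.susVar x))

end MCaTT

/-- The substitution `•_Γ : ↑↓Γ → Γ`. -/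
def CaTT.Ctx.bullet (new : Finset Var → Var) (Γ : CaTT.Ctx) : CaTT.Sub :=
  (Γ.desusp.frame new).bullet Γ

namespace MCaTT

mutual
/-- The reduced suspension of a type over a context with frame `F`. -/
def Ty.sus (new : Finset Var → Var) (F : Frame) : Ty → CaTT.Ty
  | .unit => .obj
  | .hom A t u => .hom (A.sus new F) (t.sus new F) (u.sus new F)
/-- The reduced suspension of a term over a context with frame `F`. -/
def Tm.sus (new : Finset Var → Var) (F : Frame) : Tm → CaTT.Tm
  | .var x => .var (F.susVar x)
  | .star => .var F.pt
  | .constr k Γ A γ =>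
      .constr k Γ A ((Γ.bullet new).comp (γ.sus new F (Γ.desusp.frame new)))
/-- The reduced suspension of a substitution from a context with frame `F` to a context with
frame `G`. -/
def Sub.sus (new : Finset Var → Var) (F : Frame) : Sub → Frame → CaTT.Sub
  | .nil, G => .cons .nil G.pt (.var F.pt)
  | .cons γ x t, G =>
      if x ∈ G.units then γ.sus new F G else .cons (γ.sus new F G) x (t.sus new F)
end

/-- The reduced suspension of the declarations of a context, over a context with frame `F`. -/
def Ctx.susIn (new : Finset Var → Var) (F : Frame) : Ctx → CaTT.Ctx
  | .nil => .cons .nil F.pt .obj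
  | .cons Γ _ .unit => Γ.susIn new F
  | .cons Γ x (.hom A t u) => .cons (Γ.susIn new F) x ((Ty.hom A t u).sus new F)

/-- The reduced suspension of a context. -/
def Ctx.sus (new : Finset Var → Var) (Γ : Ctx) : CaTT.Ctx := Γ.susIn new (Γ.frame new)

/-- The substitution `η_Γ : Γ → ↓↑Γ`, for a context with frame `F`: it sends `•` to `()`, and every
variable whose type is not `𝟙` to itself. -/
def Ctx.etaIn (F : Frame) : Ctx → Sub
  | .nil => .cons .nil F.pt .star
  | .cons Γ _ .unit => Γ.etaIn F
  | .cons Γ x (.hom _ _ _) => .cons (Γ.etaIn F) x (.var x)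

/-- The substitution `η_Γ : Γ → ↓↑Γ`. -/
def Ctx.eta (new : Finset Var → Var) (Γ : Ctx) : Sub := Γ.etaIn (Γ.frame new)

/-! ### Properties of the reduced suspension -/

theorem Ctx.mem_unitVars {x : Var} : ∀ {Γ : Ctx}, x ∈ Γ.unitVars ↔ Γ.Mem x .unit
  | .nil => by simp [Ctx.unitVars, Ctx.Mem]
  | .cons Γ y .unit => by simp [Ctx.unitVars, Ctx.Mem, Ctx.mem_unitVars (Γ := Γ)]
  | .cons Γ y (.hom _ _ _) => by simp [Ctx.unitVars, Ctx.Mem, Ctx.mem_unitVars (Γ := Γ)]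

theorem Ctx.mem_nonUnitVars {x : Var} :
    ∀ {Γ : Ctx}, x ∈ Γ.nonUnitVars ↔ ∃ A, Γ.Mem x A ∧ A ≠ .unit
  | .nil => by simp [Ctx.nonUnitVars, Ctx.Mem]
  | .cons Γ y .unit => by
      simp only [Ctx.nonUnitVars, Ctx.Mem, Ctx.mem_nonUnitVars (Γ := Γ)]
      grind
  | .cons Γ y (.hom _ _ _) => by
      simp only [Ctx.nonUnitVars, Ctx.Mem, Finset.mem_insert, Ctx.mem_nonUnitVars (Γ := Γ)]
      constructor
      · rintro (rfl | ⟨A, h, h'⟩)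
        · exact ⟨_, .inl ⟨rfl, rfl⟩, by simp⟩
        · exact ⟨A, .inr h, h'⟩
      · rintro ⟨A, ⟨rfl, _⟩ | h, h'⟩
        · exact .inl rfl
        · exact .inr ⟨A, h, h'⟩

theorem Der.mem_unique {x : Var} {A B : Ty} : ∀ {Γ : Ctx},
    Der (.ctx Γ) → Γ.Mem x A → Γ.Mem x B → A = B
  | .nil, _, h, _ => h.elim
  | .cons Γ y C, h, hA, hB => by
      cases h with
      | ce hC hx =>
        rcases hA with ⟨rfl, rfl⟩ | hA
        · rcases hB with ⟨_, rfl⟩ | hB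
          · rfl
          · exact (hx hB.mem_vars).elim
        · rcases hB with ⟨rfl, rfl⟩ | hB
          · exact (hx hA.mem_vars).elim
          · exact hC.ctx_of.mem_unique hA hB

/-- The frame `F` is suitable for the context `Γ`. -/
structure Frame.Fits (F : Frame) (Γ : Ctx) : Prop where
  units : ∀ x A, Γ.Mem x A → (x ∈ F.units ↔ A = .unit)
  pt : ∀ x A, Γ.Mem x A → A ≠ .unit → x ≠ F.pt

theorem Frame.Fits.tail {F : Frame} {Γ : Ctx} {x : Var} {A : Ty} (h : F.Fits (.cons Γ x A)) :
    F.Fits Γ :=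
  ⟨fun y B hB => h.units y B (.inr hB), fun y B hB => h.pt y B (.inr hB)⟩

theorem Der.fits {new : Finset Var → Var} (hnew : ∀ s, new s ∉ s) {Γ : Ctx}
    (h : Der (.ctx Γ)) : (Γ.frame new).Fits Γ where
  units x A hA := by
    simp only [Ctx.frame, Ctx.mem_unitVars]
    exact ⟨fun hB => h.mem_unique hA hB, fun e => e ▸ hA⟩
  pt x A hA hne e := by
    refine hnew Γ.nonUnitVars (Ctx.mem_nonUnitVars.2 ⟨A, ?_, hne⟩)
    rw [e] at hA
    exact hA

theorem vars_susIn {new : Finset Var → Var} {F : Frame} {x : Var} : ∀ {Γ : Ctx},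
    x ∈ (Γ.susIn new F).vars → x = F.pt ∨ x ∈ Γ.vars
  | .nil => by
      intro h
      exact .inl (by simpa [Ctx.susIn, CaTT.Ctx.vars] using h)
  | .cons Γ y .unit => by
      intro h
      simp only [Ctx.vars, Finset.mem_insert]
      have := vars_susIn (Γ := Γ) h
      tauto
  | .cons Γ y (.hom A t u) => by
      intro h
      simp only [Ctx.susIn, CaTT.Ctx.vars, Ctx.vars, Finset.mem_insert] at h ⊢
      have := vars_susIn (new := new) (F := F) (x := x) (Γ := Γ)
      tauto

/-- The reduced suspension respects definitional equality. -/
theorem Der.sus_eq {new : Finset Var → Var} {J : Judgment} (h : Der J) :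
    match J with
    | .tm Γ t A => ∀ {F : Frame}, F.Fits Γ → A = .unit → t.sus new F = .var F.pt
    | .tyEq Γ A B => (A = .unit ↔ B = .unit) ∧
        ∀ {F : Frame}, F.Fits Γ → A.sus new F = B.sus new F
    | .tmEq Γ t u _ => ∀ {F : Frame}, F.Fits Γ → t.sus new F = u.sus new F
    | .subEq Δ γ δ _ => ∀ {F : Frame} (G : Frame), F.Fits Δ → γ.sus new F G = δ.sus new F G
    | _ => True := by
  induction h with
  | var _ hm _ =>
      intro F hF e
      simp [Tm.sus, Frame.susVar, (hF.units _ _ hm).2 e]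
  | star => intro F _ _; rfl
  | constr _ hc _ _ =>
      intro F _ e
      cases hc <;> simp [CaTT.Ty.desusp, Ty.subst] at e
  | conv _ _ h1 h2 => intro F hF e; exact h1 hF (h2.1.2 e)
  | eta _ _ h1 h2 => intro F hF; rw [h1 hF rfl, h2 hF rfl]
  | tyRefl => exact ⟨Iff.rfl, fun _ => rfl⟩
  | tySymm _ h => exact ⟨h.1.symm, fun hF => (h.2 hF).symm⟩
  | tyTrans _ _ h1 h2 => exact ⟨h1.1.trans h2.1, fun hF => (h1.2 hF).trans (h2.2 hF)⟩
  | homCongr _ _ _ h0 h1 h2 =>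
      refine ⟨by simp, fun hF => ?_⟩
      simp only [Ty.sus, h0.2 hF, h1 hF, h2 hF]
  | tmRefl => intro F _; rfl
  | tmSymm _ h => intro F hF; exact (h hF).symm
  | tmTrans _ _ h1 h2 => intro F hF; exact (h1 hF).trans (h2 hF)
  | tmConv _ _ h _ => intro F hF; exact h hF
  | constrCongr _ _ _ h => intro F hF; simp only [Tm.sus, h _ hF]
  | esEq => intro F G _; rfl
  | seEq _ _ _ _ h1 _ h2 => intro F G hF; simp only [Sub.sus, h1 G hF, h2 hF]
  | _ => trivial

theorem CtxEq.frame_eq {new : Finset Var → Var} {Γ Γ' : Ctx} (h : CtxEq Γ Γ') :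
    Γ.frame new = Γ'.frame new := by
  have : Γ.unitVars = Γ'.unitVars ∧ Γ.nonUnitVars = Γ'.nonUnitVars := by
    induction h with
    | nil => exact ⟨rfl, rfl⟩
    | @cons Γ Γ' x A A' _ e ih =>
        have e := (e.sus_eq (new := new)).1
        cases A <;> cases A' <;> simp [Ctx.unitVars, Ctx.nonUnitVars, ih] at e ⊢
  simp only [Ctx.frame, this]

theorem CtxEq.sus_eq {new : Finset Var → Var} (hnew : ∀ s, new s ∉ s) {Γ Γ' : Ctx}
    (h : CtxEq Γ Γ') (hΓ : Der (.ctx Γ)) : Γ.sus new = Γ'.sus new := by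
  have key : ∀ F : Frame, F.Fits Γ → Γ.susIn new F = Γ'.susIn new F := by
    clear hΓ
    intro F hF
    induction h with
    | nil => rfl
    | @cons Γ Γ' x A A' _ e ih =>
        have ih := ih hF.tail
        obtain ⟨e, e'⟩ := e.sus_eq (new := new)
        have e' := e' hF.tail
        cases A <;> cases A' <;> simp [Ctx.susIn, ih, e'] at e ⊢
  rw [Ctx.sus, key _ (hΓ.fits hnew), h.frame_eq, Ctx.sus]

theorem Sub.sus_get_pt {new : Finset Var → Var} {F G : Frame} {Δ : Ctx} : ∀ {Γ : Ctx} {γ : Sub},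
    G.Fits Γ → Der (.sub Δ γ Γ) → (γ.sus new F G).get G.pt = .var F.pt
  | .nil, _, _, h => by cases h; simp [Sub.sus, CaTT.Sub.get]
  | .cons Γ x A, _, hG, h => by
      cases h with
      | se h1 _ _ _ =>
        have ih := Sub.sus_get_pt (new := new) (F := F) hG.tail h1
        simp only [Sub.sus]
        split_ifs with hx
        · exact ih
        · have hA : A ≠ .unit := fun e => hx ((hG.units x A (.inl ⟨rfl, rfl⟩)).2 e)
          have : G.pt ≠ x := (hG.pt x A (.inl ⟨rfl, rfl⟩) hA).symm
          simpa [CaTT.Sub.get, this] using ih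

theorem Sub.sus_get {new : Finset Var → Var} {F G : Frame} {Δ : Ctx} {x : Var} :
    ∀ {Γ : Ctx} {γ : Sub}, F.Fits Δ → G.Fits Γ → Der (.sub Δ γ Γ) → x ∈ Γ.vars →
      (γ.sus new F G).get (G.susVar x) = (γ.get x).sus new F
  | .nil, _, _, _, _, hx => by simp [Ctx.vars] at hx
  | .cons Γ y A, _, hF, hG, h, hx => by
      have h' := h
      cases h with
      | @se _ _ γ _ _ t h1 h2 h3 h4 =>
        have hy := hG.units y A (.inl ⟨rfl, rfl⟩)
        by_cases hxy : x = y
        · subst hxy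
          by_cases hu : x ∈ G.units
          · have e : Ty.subst A γ = .unit := by rw [hy.1 hu]; rfl
            simp only [Sub.get, if_true, h4.sus_eq hF e, Frame.susVar, hu]
            exact Sub.sus_get_pt hG h'
          · simp [Sub.get, Frame.susVar, hu, Sub.sus, CaTT.Sub.get]
        · have hx' : x ∈ Γ.vars := by simpa [Ctx.vars, hxy] using hx
          have ih := Sub.sus_get (new := new) hF hG.tail h1 hx'
          simp only [Sub.get, hxy, if_false, ← ih, Sub.sus]
          split_ifs with hu
          · rfl
          · have hA : A ≠ .unit := fun e => hu (hy.2 e)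
            have : G.susVar x ≠ y := by
              unfold Frame.susVar
              split_ifs
              · exact (hG.pt y A (.inl ⟨rfl, rfl⟩) hA).symm
              · exact hxy
            simp [CaTT.Sub.get, this]

theorem Frame.vars_bullet (F : Frame) : ∀ Γ : CaTT.Ctx, (F.bullet Γ).vars = Γ.vars.image F.susVar
  | .nil => rfl
  | .cons Γ x A => by
      have := F.vars_bullet Γ
      simp only [Frame.bullet, CaTT.Sub.vars, CaTT.Tm.vars, CaTT.Ctx.vars, Finset.image_insert, this]
      grind

theorem Frame.dom_bullet (F : Frame) : ∀ Γ : CaTT.Ctx, (F.bullet Γ).dom = Γ.vars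
  | .nil => rfl
  | .cons Γ x A => by simp only [Frame.bullet, CaTT.Sub.dom, CaTT.Ctx.vars, F.dom_bullet Γ]

theorem Sub.pt_mem_dom_sus {new : Finset Var → Var} {F G : Frame} :
    ∀ γ : Sub, G.pt ∈ (γ.sus new F G).dom
  | .nil => by simp [Sub.sus, CaTT.Sub.dom]
  | .cons γ y t => by
      have := Sub.pt_mem_dom_sus (new := new) (F := F) (G := G) γ
      simp only [Sub.sus]
      split_ifs <;> simp [CaTT.Sub.dom, this]

theorem Sub.mem_dom_sus {new : Finset Var → Var} {F G : Frame} {x : Var} :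
    ∀ {γ : Sub}, x ∈ γ.dom → G.susVar x ∈ (γ.sus new F G).dom
  | .nil, h => by simp [Sub.dom] at h
  | .cons γ y t, h => by
      by_cases hx : x ∈ G.units
      · simp only [Frame.susVar, hx, if_true, Sub.pt_mem_dom_sus]
      · by_cases hxy : x = y
        · subst hxy
          simp [Sub.sus, Frame.susVar, hx, CaTT.Sub.dom]
        · have := Sub.mem_dom_sus (new := new) (F := F) (G := G) (x := x) (γ := γ)
            (by simpa [Sub.dom, hxy] using h)
          simp only [Sub.sus]
          split_ifs <;> simp [CaTT.Sub.dom, this]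

theorem vars_bullet_subset {new : Finset Var → Var} {F : Frame} {Θ : CaTT.Ctx} {Δ : Ctx} {γ : Sub}
    (h : Der (.sub Δ γ Θ.desusp)) :
    (Θ.bullet new).vars ⊆ (γ.sus new F (Θ.desusp.frame new)).dom := by
  rw [CaTT.Ctx.bullet, Frame.vars_bullet]
  intro z hz
  obtain ⟨y, hy, rfl⟩ := Finset.mem_image.1 hz
  exact Sub.mem_dom_sus (by rwa [h.sub_dom, vars_desusp_ctx])

/-- The reduced suspension commutes with the action of substitutions. -/
theorem Der.sus_subst {new : Finset Var → Var} {J : Judgment} (h : Der J) :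
    match J with
    | .ty Γ A => ∀ {Λ γ} {F G : Frame}, F.Fits Λ → G.Fits Γ → Der (.sub Λ γ Γ) →
        (A.subst γ).sus new F = (A.sus new G).subst (γ.sus new F G)
    | .tm Γ t _ => ∀ {Λ γ} {F G : Frame}, F.Fits Λ → G.Fits Γ → Der (.sub Λ γ Γ) →
        (t.subst γ).sus new F = (t.sus new G).subst (γ.sus new F G)
    | .sub Γ δ _ => ∀ {Λ γ} {F G : Frame} (H : Frame), F.Fits Λ → G.Fits Γ → Der (.sub Λ γ Γ) →
        (δ.comp γ).sus new F H = (δ.sus new G H).comp (γ.sus new F G)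
    | _ => True := by
  induction h with
  | unit _ _ => intro _ _ _ _ _ _ _; rfl
  | hom _ _ _ h0 h1 h2 =>
      intro Λ γ F G hF hG hγ
      simp only [Ty.subst, Ty.sus, CaTT.Ty.subst, h0 hF hG hγ, h1 hF hG hγ, h2 hF hG hγ]
  | var _ hm _ =>
      intro Λ γ F G hF hG hγ
      exact (Sub.sus_get hF hG hγ hm.mem_vars).symm
  | star =>
      intro Λ γ F G hF hG hγ
      exact (Sub.sus_get_pt hG hγ).symm
  | constr _ _ hs ih =>
      intro Λ γ F G hF hG hγ
      simp only [Tm.subst, Tm.sus, CaTT.Tm.subst, ih _ hF hG hγ]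
      rw [CaTT.Sub.comp_assoc _ (vars_bullet_subset hs)]
  | conv _ _ h _ => exact h
  | es =>
      intro Λ γ F G H hF hG hγ
      simp [Sub.comp, Sub.sus, CaTT.Sub.comp, CaTT.Tm.subst, Sub.sus_get_pt hG hγ]
  | se _ _ _ _ h1 _ h2 =>
      intro Λ γ F G H hF hG hγ
      simp only [Sub.comp, Sub.sus, h1 H hF hG hγ, h2 hF hG hγ]
      split_ifs <;> rfl
  | _ => trivial

theorem Frame.bullet_get {F : Frame} {x : Var} : ∀ {Θ : CaTT.Ctx}, x ∈ Θ.vars →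
    (F.bullet Θ).get x = .var (F.susVar x)
  | .nil, h => by simp [CaTT.Ctx.vars] at h
  | .cons Θ y A, h => by
      by_cases hxy : x = y
      · simp [Frame.bullet, CaTT.Sub.get, hxy]
      · have := Frame.bullet_get (F := F) (x := x) (Θ := Θ) (by simpa [CaTT.Ctx.vars, hxy] using h)
        simpa [Frame.bullet, CaTT.Sub.get, hxy] using this

theorem Frame.subst_bullet_congr {F : Frame} {Θ Θ' : CaTT.Ctx} {A : CaTT.Ty}
    (h : A.vars ⊆ Θ.vars) (h' : A.vars ⊆ Θ'.vars) :
    A.subst (F.bullet Θ) = A.subst (F.bullet Θ') :=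
  A.subst_congr fun x hx => by rw [Frame.bullet_get (h hx), Frame.bullet_get (h' hx)]

theorem Frame.subst_bullet_congr_tm {F : Frame} {Θ Θ' : CaTT.Ctx} {t : CaTT.Tm}
    (h : t.vars ⊆ Θ.vars) (h' : t.vars ⊆ Θ'.vars) :
    t.subst (F.bullet Θ) = t.subst (F.bullet Θ') :=
  t.subst_congr fun x hx => by rw [Frame.bullet_get (h hx), Frame.bullet_get (h' hx)]

theorem Frame.Fits.mono {F : Frame} {Γ Γ' : Ctx} (h : F.Fits Γ)
    (hm : ∀ x B, Γ'.Mem x B → Γ.Mem x B) : F.Fits Γ' :=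
  ⟨fun x A hA => h.units x A (hm _ _ hA), fun x A hA => h.pt x A (hm _ _ hA)⟩

/-- The substitution `•` acts on the types in a context as the desuspension followed by the reduced
suspension. -/
def BulletCtx (new : Finset Var → Var) (Θ : CaTT.Ctx) : Prop :=
  ∀ (F : Frame) (x : Var) (B : CaTT.Ty), F.Fits Θ.desusp → Θ.Mem x B →
    B.subst (F.bullet Θ) = B.desusp.sus new F

/-- The substitution `•` acts as the desuspension followed by the reduced suspension. -/
theorem _root_.CaTT.Der.subst_bullet {new : Finset Var → Var} (hnew : ∀ s, new s ∉ s)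
    {J : CaTT.Judgment} (h : CaTT.Der J) :
    match J with
    | .ctx Θ => BulletCtx new Θ
    | .ty Θ A => BulletCtx new Θ ∧
        ∀ {F : Frame}, F.Fits Θ.desusp → A.subst (F.bullet Θ) = A.desusp.sus new F
    | .tm Θ t A => BulletCtx new Θ ∧ ∀ {F : Frame}, F.Fits Θ.desusp →
        t.subst (F.bullet Θ) = t.desusp.sus new F ∧ A.subst (F.bullet Θ) = A.desusp.sus new F
    | .sub Θ δ Ψ => BulletCtx new Θ ∧ ∀ {F G : Frame}, F.Fits Θ.desusp → G.Fits Ψ.desusp →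
        δ.comp (F.bullet Θ) = (G.bullet Ψ).comp (δ.desusp.sus new F G)
    | .cell _ Θ A => ∀ {F : Frame}, F.Fits Θ.desusp →
        A.subst (F.bullet Θ) = A.desusp.sus new F := by
  induction h with
  | ec => intro F x B _ hm; exact hm.elim
  | @ce Θ x A hA _ ih =>
      intro F y B hF hm
      have hs : Θ.vars ⊆ (Θ.cons x A).vars := by simp [CaTT.Ctx.vars]
      rcases hm with ⟨_, rfl⟩ | hm
      · rw [← ih.2 hF.tail]
        exact Frame.subst_bullet_congr (hA.scoped.1.trans hs) hA.scoped.1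
      · rw [← ih.1 F y B hF.tail hm]
        exact Frame.subst_bullet_congr ((hA.scoped.2 _ _ hm).trans hs) (hA.scoped.2 _ _ hm)
  | obj _ ih => exact ⟨ih, fun _ => rfl⟩
  | hom _ _ h1 h2 =>
      refine ⟨h1.1, fun hF => ?_⟩
      simp only [CaTT.Ty.subst, CaTT.Ty.desusp, Ty.sus, (h1.2 hF).1, (h1.2 hF).2, (h2.2 hF).1]
  | var _ hm ih => exact ⟨ih, fun hF => ⟨Frame.bullet_get hm.mem_vars, ih _ _ _ hF hm⟩⟩
  | @constr k Γ Θ A γ hc hs ih1 ih =>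
      refine ⟨ih.1, fun {F} hF => ⟨?_, ?_⟩⟩
      · simp only [CaTT.Tm.subst, CaTT.Tm.desusp, Tm.sus, CaTT.Ctx.bullet]
        rw [ih.2 hF (hs.desusp.2.fits hnew)]
      · have hG := hs.desusp.2.fits hnew
        rw [← CaTT.Ty.subst_comp _ (by rw [hs.sub_dom]; exact hc.vars_cell), ih.2 hF hG,
          CaTT.Ty.desusp_subst, (hc.desusp hs.desusp.2).sus_subst hF hG hs.desusp.1, ← ih1 hG]
        refine CaTT.Ty.subst_comp _ ?_
        rw [Frame.dom_bullet]
        exact hc.vars_cell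
  | es _ ih => exact ⟨ih, fun _ _ => rfl⟩
  | @se Θ Ψ δ x A t hs hA hx ht ih1 _ ih2 =>
      refine ⟨ih1.1, fun {F G} hF hG => ?_⟩
      have hd := (CaTT.Der.se hs hA hx ht).desusp.1
      have e2 := Sub.sus_get (new := new) (x := x) hF hG hd
        (by simp [CaTT.Ctx.desusp, Ctx.vars])
      simp only [CaTT.Sub.desusp, Sub.get, if_true] at e2
      simp only [CaTT.Sub.comp, Frame.bullet, CaTT.Sub.desusp, CaTT.Tm.subst, e2]
      rw [ih1.2 hF hG.tail, (ih2.2 hF).1]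
      congr 1
      simp only [Sub.sus]
      split_ifs with hu
      · rfl
      · have hm := hG.units x A.desusp (.inl ⟨rfl, rfl⟩)
        have hpt := hG.pt x A.desusp (.inl ⟨rfl, rfl⟩) fun e => hu (hm.2 e)
        refine CaTT.Sub.comp_congr _ fun z hz => ?_
        rw [Frame.vars_bullet] at hz
        obtain ⟨y, hy, rfl⟩ := Finset.mem_image.1 hz
        have : G.susVar y ≠ x := by
          unfold Frame.susVar
          split_ifs
          · exact hpt.symm
          · exact fun e => hx (e ▸ hy)
        simp [CaTT.Sub.get, this]
  | @op Θ A t u _ _ ht hu _ _ h1 h2 =>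
      intro F hF
      have f1 := h1.2 (hF.mono (CaTT.Ctx.desusp_mono fun _ _ => CaTT.mem_srcAt _ _))
      have f2 := h2.2 (hF.mono (CaTT.Ctx.desusp_mono fun _ _ => CaTT.mem_tgtAt _ _))
      have s1 : Θ.src.vars ⊆ Θ.vars := CaTT.vars_srcAt _ _
      have s2 : Θ.tgt.vars ⊆ Θ.vars := CaTT.vars_tgtAt _ _
      rw [Frame.subst_bullet_congr_tm ht.scoped.1 (ht.scoped.1.trans s1),
        Frame.subst_bullet_congr ht.scoped.2.1 (ht.scoped.2.1.trans s1)] at f1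
      rw [Frame.subst_bullet_congr_tm hu.scoped.1 (hu.scoped.1.trans s2)] at f2
      simp only [CaTT.Ty.subst, CaTT.Ty.desusp, Ty.sus, f1.1, f1.2, f2.1]
  | coh _ _ _ _ _ h1 h2 =>
      intro F hF
      simp only [CaTT.Ty.subst, CaTT.Ty.desusp, Ty.sus, (h1.2 hF).1, (h1.2 hF).2, (h2.2 hF).1]

theorem Ctx.mem_susIn_pt {new : Finset Var → Var} {F : Frame} :
    ∀ Γ : Ctx, (Γ.susIn new F).Mem F.pt .obj
  | .nil => .inl ⟨rfl, rfl⟩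
  | .cons Γ _ .unit => Γ.mem_susIn_pt
  | .cons Γ _ (.hom _ _ _) => .inr Γ.mem_susIn_pt

theorem Ctx.mem_susIn {new : Finset Var → Var} {F : Frame} {x : Var} {A : Ty} (hA : A ≠ .unit) :
    ∀ {Γ : Ctx}, Γ.Mem x A → (Γ.susIn new F).Mem x (A.sus new F)
  | .nil, h => h.elim
  | .cons Γ y .unit, h => by
      rcases h with ⟨_, h⟩ | h
      · exact (hA h).elim
      · exact Ctx.mem_susIn hA (Γ := Γ) h
  | .cons Γ y (.hom _ _ _), h => by
      rcases h with ⟨rfl, rfl⟩ | h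
      · exact .inl ⟨rfl, rfl⟩
      · exact .inr (Ctx.mem_susIn hA (Γ := Γ) h)

/-- The family `•` consists of derivable substitutions. -/
theorem der_bullet {new : Finset Var → Var} (hnew : ∀ s, new s ∉ s) {F : Frame} :
    ∀ {Θ : CaTT.Ctx}, F.Fits Θ.desusp → CaTT.Der (.ctx Θ) →
      CaTT.Der (.ctx (Θ.desusp.susIn new F)) →
      CaTT.Der (.sub (Θ.desusp.susIn new F) (F.bullet Θ) Θ)
  | .nil, _, _, h => .es h
  | .cons Θ x .obj, hF, hΘ, h => by
      cases hΘ with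
      | ce hA hx =>
        have hu := (hF.units x .unit (.inl ⟨rfl, rfl⟩)).2 rfl
        refine .se (der_bullet hnew hF.tail hA.ctx_of h) hA hx ?_
        simp only [Frame.susVar, hu, if_true]
        exact .var h (Ctx.mem_susIn_pt _)
  | .cons Θ x (.hom A t u), hF, hΘ, h => by
      cases hΘ with
      | ce hA hx =>
        have h' := h
        cases h' with
        | ce hB _ =>
          have ih := der_bullet hnew hF.tail hA.ctx_of hB.ctx_of
          have hu : x ∉ F.units := fun hu => by
            have := (hF.units x _ (.inl ⟨rfl, rfl⟩)).1 hu
            simp [CaTT.Ty.desusp] at this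
          refine .se (ih.weaken h fun _ _ h => .inr h) hA hx ?_
          rw [(hA.subst_bullet hnew).2 hF.tail]
          simp only [Frame.susVar, hu, if_false]
          exact .var h (.inl ⟨rfl, rfl⟩)

/-- The reduced suspension preserves derivability. -/
theorem Der.sus {new : Finset Var → Var} (hnew : ∀ s, new s ∉ s) {J : Judgment} (h : Der J) :
    match J with
    | .ctx Γ => ∀ {F : Frame}, F.Fits Γ → CaTT.Der (.ctx (Γ.susIn new F))
    | .ty Γ A => ∀ {F : Frame}, F.Fits Γ → CaTT.Der (.ty (Γ.susIn new F) (A.sus new F))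
    | .tm Γ t A => ∀ {F : Frame}, F.Fits Γ →
        CaTT.Der (.tm (Γ.susIn new F) (t.sus new F) (A.sus new F))
    | .sub Δ γ Γ => ∀ {F G : Frame}, F.Fits Δ → G.Fits Γ →
        CaTT.Der (.sub (Δ.susIn new F) (γ.sus new F G) (Γ.susIn new G))
    | _ => True := by
  induction h with
  | ec => intro F _; exact .ce (.obj .ec) (by simp [CaTT.Ctx.vars])
  | @ce Γ x A _ hx ih =>
      intro F hF
      cases A with
      | unit => exact (ih hF.tail).ctx_of
      | hom A t u =>
        refine .ce (ih hF.tail) fun hm => ?_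
        rcases vars_susIn hm with e | hm
        · exact hF.pt x _ (.inl ⟨rfl, rfl⟩) (by simp) e
        · exact hx hm
  | unit _ ih => intro F hF; exact .obj (ih hF)
  | hom _ _ _ _ h1 h2 => intro F hF; exact .hom (h1 hF) (h2 hF)
  | @var Γ x A h hm ih =>
      intro F hF
      by_cases hA : A = .unit
      · subst hA
        have hu := (hF.units x _ hm).2 rfl
        simp only [Tm.sus, Frame.susVar, hu, if_true, Ty.sus]
        exact .var (ih hF) (Ctx.mem_susIn_pt _)
      · have hu : x ∉ F.units := fun hu => hA ((hF.units x _ hm).1 hu)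
        simp only [Tm.sus, Frame.susVar, hu, if_false]
        exact .var (ih hF) (Ctx.mem_susIn hA hm)
  | star _ ih => intro F hF; exact .var (ih hF) (Ctx.mem_susIn_pt _)
  | @constr k Θ A Δ γ hp hc hs ih =>
      intro F hF
      have hΘ := hp.ctx
      have hG := hΘ.desusp.fits hnew
      have h1 := ih hF hG
      have h2 := (der_bullet hnew hG hΘ h1.tgt_of).subst h1
      have e : (A.desusp.subst γ).sus new F = A.subst ((Θ.bullet new).comp
          (γ.sus new F (Θ.desusp.frame new))) := by
        rw [(hc.desusp hΘ.desusp).sus_subst hF hG hs, ← hc.subst_bullet hnew hG]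
        refine (CaTT.Ty.subst_comp _ ?_).symm
        rw [Frame.dom_bullet]
        exact hc.vars_cell
      rw [e]
      exact .constr hc h2
  | conv _ hAB h1 _ => intro F hF; rw [← (hAB.sus_eq).2 hF]; exact h1 hF
  | es _ ih =>
      intro F G hF hG
      refine .se (.es (ih hF)) (.obj .ec) (by simp [CaTT.Ctx.vars]) ?_
      exact .var (ih hF) (Ctx.mem_susIn_pt _)
  | @se Δ Γ γ x A t hs hA hx ht ih1 ih2 ih3 =>
      intro F G hF hG
      have hu := hG.units x A (.inl ⟨rfl, rfl⟩)
      cases A with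
      | unit =>
        simp only [Sub.sus, hu.2 rfl, if_true]
        exact ih1 hF hG.tail
      | hom A u v =>
        have hu : x ∉ G.units := fun h => by simpa using hu.1 h
        simp only [Sub.sus, hu, if_false]
        refine .se (ih1 hF hG.tail) (ih2 hG.tail) (fun hm => ?_) ?_
        · rcases vars_susIn hm with e | hm
          · exact hG.pt x _ (.inl ⟨rfl, rfl⟩) (by simp) e
          · exact hx hm
        · rw [← hA.sus_subst hF hG.tail hs]
          exact ih3 hF
  | _ => trivial

theorem Sub.sus_id {new : Finset Var → Var} {F : Frame} : ∀ {Γ : Ctx}, F.Fits Γ →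
    Γ.id.sus new F F = (Γ.susIn new F).id
  | .nil, _ => rfl
  | .cons Γ x .unit, h => by
      have hu := (h.units x .unit (.inl ⟨rfl, rfl⟩)).2 rfl
      simp only [Ctx.id, Sub.sus, hu, if_true, Ctx.susIn, Sub.sus_id h.tail]
  | .cons Γ x (.hom A t u), h => by
      have hu : x ∉ F.units := fun hu => by
        simpa using (h.units x _ (.inl ⟨rfl, rfl⟩)).1 hu
      simp only [Ctx.id, Sub.sus, hu, if_false, Ctx.susIn, Sub.sus_id h.tail, CaTT.Ctx.id, Tm.sus,
        Frame.susVar]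

/-! ### The reduced suspension functor -/

/-- The frame of an object of the syntactic category. -/
def Syn.frame (new : Finset Var → Var) (X : Syn) : Frame :=
  Quotient.lift (fun Γ : VCtx => Γ.ctx.frame new) (fun _ _ h => CtxEq.frame_eq h) X

/-- The reduced suspension functor, determined by `↑[Γ] = ↑Γ` and `↑[γ] = ↑γ`. -/
def reducedSuspension (new : Finset Var → Var) (hnew : ∀ s, new s ∉ s) : Syn ⥤ CaTT.Syn where
  obj X := Quotient.lift
    (fun Γ : VCtx => (⟨Γ.ctx.sus new, Γ.der.sus hnew (Γ.der.fits hnew)⟩ : CaTT.Syn))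
    (fun Γ Γ' h => by simp only [CtxEq.sus_eq hnew h Γ.der]) X
  map {X Y} f :=
    { sub := Quotient.lift
        (fun p : Syn.PreHom X Y => p.sub.sus new (X.frame new) (Y.frame new))
        (fun p q h => by
          induction X using Quotient.ind with
          | _ Δ => induction Y using Quotient.ind with
            | _ Γ =>
              exact ((Syn.PreHom.eq_iff p q).1 h).sus_eq _ (Δ.der.fits hnew)) f
      der := by
        induction X using Quotient.ind with
        | _ Δ => induction Y using Quotient.ind with
          | _ Γ => induction f using Quotient.ind with
            | _ p => exact (Syn.PreHom.der' p).sus hnew (Δ.der.fits hnew) (Γ.der.fits hnew) }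
  map_id X := by
    induction X using Quotient.ind with
    | _ Γ => exact CaTT.Syn.Hom.ext (Sub.sus_id (Γ.der.fits hnew))
  map_comp {X Y Z} f g := by
    induction X using Quotient.ind with
    | _ Δ => induction Y using Quotient.ind with
      | _ Γ => induction Z using Quotient.ind with
        | _ Θ => induction f using Quotient.ind with
          | _ p => induction g using Quotient.ind with
            | _ q =>
              exact CaTT.Syn.Hom.ext ((Syn.PreHom.der' q).sus_subst _ (Δ.der.fits hnew)
                (Γ.der.fits hnew) (Syn.PreHom.der' p))

end MCaTT

-- In `MCaTT` any two terms of type `𝟙` are definitionally equal, so a variable of type `𝟙` carries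
-- no information. The context `↓↑Γ` replaces all such variables of `Γ` by a single one, `•`, and
-- this loses nothing: `η_Γ` and the substitution `Ctx.etaInv`, which sends each `x` to `↑x`, are
-- mutually inverse, because their composites differ from identities only in entries of type `𝟙`.
--
-- The real content lies in the types. The context `↓↑Γ` declares `x : ↓↑A`, so `η_Γ` is not even
-- known to be derivable before `Γ ⊢ A ≡ (↓↑A)[η_Γ]` is proved. The central lemma
-- `Der.eq_desusp_sus` establishes this by induction on derivations, together with its analogue for
-- terms and the formula `γ ≡ η_Γ⁻¹ ∘ ↓↑γ ∘ η_Δ` for substitutions. Its clause for types makes `η`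
-- derivable (`Der.etaIn`); its clause for substitutions gives `η⁻¹ ∘ η ≡ id` when applied to an
-- identity, and the naturality of `η` in general. The lemma `Der.etaInv` is the counterpart over
-- `↓↑Γ`, where `A[η⁻¹]` is compared with `↓↑A`.
--
-- In these inductions the term constructors are the delicate case: `↑` inserts `•_Θ` in front of
-- `↑γ`. But `↓•_Θ` is literally `η⁻¹` at `↓Θ` (`desusp_bullet`), which is why `η_Γ⁻¹` appears in
-- the clause for substitutions. The same identity reduces the triangle identity at `↓Θ` to `η⁻¹ ∘ η
-- = id`.
--
-- The other triangle identity holds strictly: the only variable of type `𝟙` in `↓↑Γ` is `•`, the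
-- remaining variables are those of `Γ`, so `new` returns the same name again, and both `↑η_Γ` and
-- `•_{↑Γ}` are identity substitutions. The naturality of the counit is `CaTT.Der.subst_bullet`, and
-- full faithfulness of `↑` follows formally from the invertibility of the unit.
--
-- All inductions range over arbitrary frames that fit the context: passing from `(Γ, x : A)` to `Γ`
-- must keep the name of `•`, whereas `new` may choose another name for `Γ` alone.

namespace MCaTT

-- The entries of `η` and of its inverse

/-- The substitution `↓↑Γ → Γ` inverse to `η_Γ`, for a context with frame `F`: it sends every variable
to its reduced suspension. -/
def Ctx.etaInv (F : Frame) : Ctx → Sub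
  | .nil => .nil
  | .cons Γ x _ => .cons (Γ.etaInv F) x (.var (F.susVar x))

/-- This links counit and unit: the desuspended counit at `Θ` is the inverse of the unit at `↓Θ`. It
serves the constructor cases below and a triangle identity. -/
theorem desusp_bullet (F : Frame) : ∀ Θ : CaTT.Ctx, (F.bullet Θ).desusp = Θ.desusp.etaInv F
  | .nil => rfl
  | .cons Θ x A => by
      simp only [Frame.bullet, CaTT.Sub.desusp, CaTT.Ctx.desusp, Ctx.etaInv, CaTT.Tm.desusp,
        desusp_bullet F Θ]

theorem Ctx.vars_etaInv (F : Frame) : ∀ Γ : Ctx, (Γ.etaInv F).vars = Γ.vars.image F.susVar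
  | .nil => rfl
  | .cons Γ x A => by
      have := Γ.vars_etaInv F
      simp only [Ctx.etaInv, Sub.vars, Tm.vars, Ctx.vars, Finset.image_insert, this]
      grind

theorem Ctx.etaInv_get {F : Frame} {x : Var} : ∀ {Γ : Ctx}, x ∈ Γ.vars →
    (Γ.etaInv F).get x = .var (F.susVar x)
  | .nil, h => by simp [Ctx.vars] at h
  | .cons Γ y A, h => by
      by_cases hxy : x = y
      · simp [Ctx.etaInv, Sub.get, hxy]
      · have := Ctx.etaInv_get (F := F) (x := x) (Γ := Γ) (by simpa [Ctx.vars, hxy] using h)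
        simpa [Ctx.etaInv, Sub.get, hxy] using this

/-- Lookup returns the rightmost assignment, whereas `•` is assigned first; the frame has to fit so
that no later variable shadows it. -/
theorem Ctx.etaIn_get_pt {F : Frame} : ∀ {Γ : Ctx}, F.Fits Γ → (Γ.etaIn F).get F.pt = .star
  | .nil, _ => by simp [Ctx.etaIn, Sub.get]
  | .cons Γ _ .unit, h => Ctx.etaIn_get_pt (Γ := Γ) h.tail
  | .cons Γ x (.hom _ _ _), h => by
      have := (h.pt x _ (.inl ⟨rfl, rfl⟩) (by simp)).symm
      simpa [Ctx.etaIn, Sub.get, this] using Ctx.etaIn_get_pt h.tail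

/-- No freshness is needed here: whichever assignment to `x` is found first, it sends `x` to itself.
-/
theorem Ctx.etaIn_get {F : Frame} {x : Var} {A : Ty} (hA : A ≠ .unit) :
    ∀ {Γ : Ctx}, Γ.Mem x A → (Γ.etaIn F).get x = .var x
  | .nil, h => h.elim
  | .cons Γ y .unit, h => by
      rcases h with ⟨_, h⟩ | h
      · exact (hA h).elim
      · exact Ctx.etaIn_get hA (Γ := Γ) h
  | .cons Γ y (.hom _ _ _), h => by
      by_cases hxy : x = y
      · simp [Ctx.etaIn, Sub.get, hxy]
      · rcases h with ⟨e, _⟩ | h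
        · exact (hxy e).elim
        · simpa [Ctx.etaIn, Sub.get, hxy] using Ctx.etaIn_get hA h

/-- The last entry of a substitution does not affect the other variables of its target. -/
theorem Ctx.etaInv_comp_sus_cons {new : Finset Var → Var} {F G : Frame} {Γ : Ctx} {γ : Sub}
    {x : Var} {A : Ty} {t : Tm} (hG : G.Fits (.cons Γ x A)) (hx : x ∉ Γ.vars) :
    (Γ.etaInv G).comp ((γ.cons x t).sus new F G).desusp =
      (Γ.etaInv G).comp (γ.sus new F G).desusp := by
  simp only [Sub.sus]
  split_ifs with hu
  · rfl
  · have hm := hG.units x A (.inl ⟨rfl, rfl⟩)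
    have hpt := hG.pt x A (.inl ⟨rfl, rfl⟩) fun e => hu (hm.2 e)
    refine Sub.comp_congr _ fun z hz => ?_
    rw [Ctx.vars_etaInv] at hz
    obtain ⟨y, hy, rfl⟩ := Finset.mem_image.1 hz
    -- A variable used by `η_Γ⁻¹` is either `•`, which differs from `x` because the frame fits, or a
    -- variable of `Γ`, from which `x` is fresh.
    have : G.susVar y ≠ x := by
      unfold Frame.susVar
      split_ifs
      · exact hpt.symm
      · exact fun e => hx (e ▸ hy)
    simp [CaTT.Sub.desusp, Sub.get, this]

-- Comparison of expressions with the desuspension of their reduced suspension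

/-- Up to `η` and its inverse, every expression is the desuspension of its reduced suspension. -/
theorem Der.eq_desusp_sus {new : Finset Var → Var} (hnew : ∀ s, new s ∉ s) {J : Judgment}
    (h : Der J) :
    match J with
    | .ty Γ A => ∀ {F : Frame}, F.Fits Γ →
        Der (.tyEq Γ A ((A.sus new F).desusp.subst (Γ.etaIn F)))
    | .tm Γ t A => ∀ {F : Frame}, F.Fits Γ →
        Der (.tmEq Γ t ((t.sus new F).desusp.subst (Γ.etaIn F)) A)
    | .sub Δ γ Γ => ∀ {F G : Frame}, F.Fits Δ → G.Fits Γ →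
        Der (.subEq Δ γ (((Γ.etaInv G).comp (γ.sus new F G).desusp).comp (Δ.etaIn F)) Γ)
    | _ => True := by
  induction h with
  | unit h _ => intro F _; exact .tyRefl (.unit h)
  | hom _ _ _ h0 h1 h2 => intro F hF; exact .homCongr (h0 hF) (h1 hF) (h2 hF)
  | @var Γ x A h hm _ =>
      intro F hF
      by_cases hA : A = .unit
      · subst hA
        have hu := (hF.units x _ hm).2 rfl
        simp only [Tm.sus, Frame.susVar, hu, if_true, CaTT.Tm.desusp, Tm.subst,
          Ctx.etaIn_get_pt hF]
        -- Here `↑x = •`, which `η` sends to `()`. This is the only case of the induction that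
        -- invokes the rule identifying terms of type `𝟙`.
        exact .eta (.var h hm) (.star h)
      · have hu : x ∉ F.units := fun hu => hA ((hF.units x _ hm).1 hu)
        simp only [Tm.sus, Frame.susVar, hu, if_false, CaTT.Tm.desusp, Tm.subst,
          Ctx.etaIn_get hA hm]
        exact .tmRefl (.var h hm)
  | star h _ =>
      intro F hF
      simp only [Tm.sus, CaTT.Tm.desusp, Tm.subst, Ctx.etaIn_get_pt hF]
      exact .tmRefl (.star h)
  | constr hp hc hs ih =>
      intro F hF
      -- The argument `•_Θ ∘ ↑γ` desuspends to `η⁻¹ ∘ ↓↑γ`, where `η⁻¹` is taken at `↓Θ`, so after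
      -- composing with `η` it is exactly the right side of the induction hypothesis for `γ`.
      simp only [Tm.sus, CaTT.Tm.desusp, Tm.subst, CaTT.Sub.desusp_comp, CaTT.Ctx.bullet,
        desusp_bullet]
      exact .constrCongr hp hc (ih hF (hp.ctx.desusp.fits hnew))
  | conv _ hAB h1 _ => intro F hF; exact .tmConv (h1 hF) hAB
  | es h _ => intro F G _ _; exact .esEq h
  | @se Δ Γ γ x A t hs hA hx ht ih1 _ ih2 =>
      intro F G hF hG
      -- The entry of `↑⟨γ, x ↦ t⟩` at `↑x` is `↑t` even when `x : 𝟙` and its assignment has been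
      -- discarded: then `↑x` is `•`, and `t` has type `𝟙`, so that `↑t` is `•` as well.
      have e := Sub.sus_get (new := new) (x := x) hF hG (.se hs hA hx ht) (by simp [Ctx.vars])
      simp only [Sub.get, if_true] at e
      simp only [Ctx.etaInv, Sub.comp, Ctx.etaInv_comp_sus_cons hG hx, Tm.subst,
        ← CaTT.Sub.desusp_get, e]
      exact .seEq (ih1 hF hG.tail) hA hx (ih2 hF)
  | _ => trivial

/-- The inverse of `η` is derivable and natural. -/
theorem Der.etaInv {new : Finset Var → Var} (hnew : ∀ s, new s ∉ s) {J : Judgment} (h : Der J) :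
    match J with
    | .ctx Γ => ∀ {F : Frame}, F.Fits Γ →
        Der (.sub (Γ.susIn new F).desusp (Γ.etaInv F) Γ)
    | .ty Γ A => ∀ {F : Frame}, F.Fits Γ →
        Der (.sub (Γ.susIn new F).desusp (Γ.etaInv F) Γ) ∧
        Der (.tyEq (Γ.susIn new F).desusp (A.subst (Γ.etaInv F)) (A.sus new F).desusp)
    | .tm Γ t A => ∀ {F : Frame}, F.Fits Γ →
        Der (.sub (Γ.susIn new F).desusp (Γ.etaInv F) Γ) ∧
        Der (.tmEq (Γ.susIn new F).desusp (t.subst (Γ.etaInv F)) (t.sus new F).desusp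
          (A.subst (Γ.etaInv F)))
    | .sub Δ γ Γ => ∀ {F : Frame}, F.Fits Δ →
        Der (.sub (Δ.susIn new F).desusp (Δ.etaInv F) Δ) ∧
        ∀ {G : Frame}, G.Fits Γ → Der (.subEq (Δ.susIn new F).desusp (γ.comp (Δ.etaInv F))
          ((Γ.etaInv G).comp (γ.sus new F G).desusp) Γ)
    | _ => True := by
  induction h with
  | ec =>
      intro F hF
      exact .es (Der.ec.sus hnew hF).desusp
  | @ce Γ x A hA hx ih =>
      intro F hF
      have hΓ := ((Der.ce hA hx).sus hnew hF).desusp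
      have hu := hF.units x A (.inl ⟨rfl, rfl⟩)
      obtain ⟨h1, h2⟩ := ih hF.tail
      cases A with
      | unit =>
        refine .se h1 hA hx ?_
        simp only [Frame.susVar, hu.2 rfl, if_true]
        exact .var hΓ (CaTT.Ctx.mem_desusp.2 ⟨_, Ctx.mem_susIn_pt _, rfl⟩)
      | hom A t u =>
        have hu : x ∉ F.units := fun h => by simpa using hu.1 h
        refine .se (h1.weaken hΓ fun _ _ h => .inr h) hA hx ?_
        simp only [Frame.susVar, hu, if_false]
        -- The variable `x` has type `↓↑A` in `↓↑(Γ, x : A)`, while an entry of type `A[η⁻¹]` is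
        -- required. Hence derivability of `η⁻¹` and the comparison of types must be proved
        -- simultaneously.
        exact .conv (.var hΓ (.inl ⟨rfl, rfl⟩)) (.tySymm (h2.weaken hΓ fun _ _ h => .inr h))
  | unit h ih => intro F hF; exact ⟨ih hF, .tyRefl (.unit (ih hF).ctx_of)⟩
  | hom _ _ _ h0 h1 h2 =>
      intro F hF
      exact ⟨(h0 hF).1, .homCongr (h0 hF).2 (h1 hF).2 (h2 hF).2⟩
  | @var Γ x A h hm ih =>
      intro F hF
      refine ⟨ih hF, ?_⟩
      have := (ih hF).get hm
      simp only [Tm.subst, Tm.sus, CaTT.Tm.desusp, Ctx.etaInv_get hm.mem_vars] at this ⊢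
      exact .tmRefl this
  | star h ih =>
      intro F hF
      -- Substitution fixes `()`, whereas `↓↑()` is `•`; the two agree because both have type `𝟙`.
      refine ⟨ih hF, .eta (.star (ih hF).ctx_of) (.var (ih hF).ctx_of ?_)⟩
      exact CaTT.Ctx.mem_desusp.2 ⟨_, Ctx.mem_susIn_pt _, rfl⟩
  | constr hp hc hs ih =>
      intro F hF
      refine ⟨(ih hF).1, ?_⟩
      simp only [Tm.sus, CaTT.Tm.desusp, Tm.subst, CaTT.Sub.desusp_comp, CaTT.Ctx.bullet,
        desusp_bullet]
      rw [← Ty.subst_comp _ (by rw [hs.sub_dom]; exact vars_cell hc)]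
      exact .constrCongr hp hc ((ih hF).2 (hp.ctx.desusp.fits hnew))
  | conv _ hAB h1 _ =>
      intro F hF
      -- Transporting `A ≡ B` along `η⁻¹` requires `η⁻¹` to be derivable, and the premises of this
      -- rule provide no judgment `Γ ⊢`; this is why the clauses for types, terms and substitutions
      -- carry derivability along.
      exact ⟨(h1 hF).1, .tmConv (h1 hF).2 (hAB.subst (h1 hF).1)⟩
  | es h ih => intro F hF; exact ⟨ih hF, fun _ => .esEq (ih hF).ctx_of⟩
  | @se Δ Γ γ x A t hs hA hx ht ih1 _ ih2 =>
      intro F hF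
      refine ⟨(ih1 hF).1, fun {G} hG => ?_⟩
      have e := Sub.sus_get (new := new) (x := x) hF hG (.se hs hA hx ht) (by simp [Ctx.vars])
      simp only [Sub.get, if_true] at e
      simp only [Ctx.etaInv, Sub.comp, Ctx.etaInv_comp_sus_cons hG hx, Tm.subst,
        ← CaTT.Sub.desusp_get, e]
      refine .seEq ((ih1 hF).2 hG.tail) hA hx ?_
      rw [Ty.subst_comp _ (by rw [hs.sub_dom]; exact hA.scoped.1)]
      exact (ih2 hF).2
  | _ => trivial

-- Derivability of `η` and its two composites with `η⁻¹`

/-- The family `η` consists of derivable substitutions. -/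
theorem Der.etaIn {new : Finset Var → Var} (hnew : ∀ s, new s ∉ s) {F : Frame} :
    ∀ {Γ : Ctx}, Der (.ctx Γ) → F.Fits Γ → Der (.sub Γ (Γ.etaIn F) (Γ.susIn new F).desusp)
  | .nil, h, _ =>
      .se (.es h) (.unit .ec) (Finset.notMem_empty _) (.star h)
  | .cons Γ x .unit, h, hF => by
      cases h with
      | ce hA hx => exact (hA.ctx_of.etaIn hnew hF.tail).weaken (.ce hA hx) fun _ _ h => .inr h
  | .cons Γ x (.hom A t u), h, hF => by
      have hs := (h.sus hnew hF).desusp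
      cases hs with
      | ce hB hy =>
        have h' := h
        cases h' with
        | ce hA hx =>
          refine .se ((hA.ctx_of.etaIn hnew hF.tail).weaken h fun _ _ h => .inr h) hB hy ?_
          -- The entry `x : A` must have type `(↓↑A)[η_Γ]`; the clause for types of
          -- `Der.eq_desusp_sus` supplies the conversion.
          exact .conv (.var h (.inl ⟨rfl, rfl⟩))
            ((hA.eq_desusp_sus hnew hF.tail).weaken h fun _ _ h => .inr h)

/-- This is `γ ≡ η⁻¹ ∘ ↓↑γ ∘ η` for `γ = id`, since both `↑` and `↓` preserve identities strictly.
-/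
theorem Der.etaInv_comp_etaIn {new : Finset Var → Var} (hnew : ∀ s, new s ∉ s) {F : Frame}
    {Γ : Ctx} (h : Der (.ctx Γ)) (hF : F.Fits Γ) :
    Der (.subEq Γ Γ.id ((Γ.etaInv F).comp (Γ.etaIn F)) Γ) := by
  have := h.id.eq_desusp_sus hnew hF hF
  rwa [Sub.sus_id hF, CaTT.Ctx.desusp_id,
    Sub.comp_eq_self (fun x => Ctx.get_id x _) (Γ.etaInv F)] at this

/-- Since `η_Γ` is derivable over `Γ`, it mentions only variables of `Γ`, so an additional last
entry of `η⁻¹` is never read. This allows the induction on `Γ` in `Der.etaIn_comp_etaInv`. -/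
theorem Der.etaIn_comp_etaInv_cons {new : Finset Var → Var} (hnew : ∀ s, new s ∉ s) {F : Frame}
    {Γ : Ctx} {x : Var} {A : Ty} (h : Der (.ctx Γ)) (hF : F.Fits Γ) (hx : x ∉ Γ.vars) :
    (Γ.etaIn F).comp ((Γ.cons x A).etaInv F) = (Γ.etaIn F).comp (Γ.etaInv F) := by
  refine Sub.comp_congr _ fun z hz => ?_
  have : z ≠ x := fun e => hx (e ▸ (h.etaIn hnew hF).scoped hz)
  simp [Ctx.etaInv, Sub.get, this]

/-- In contrast to the other composite, entries can be compared directly: kept variables are fixed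
on the nose by both substitutions, and only `•`, sent to `()`, needs a definitional equality. -/
theorem Der.etaIn_comp_etaInv {new : Finset Var → Var} (hnew : ∀ s, new s ∉ s) {F : Frame} :
    ∀ {Γ : Ctx}, Der (.ctx Γ) → F.Fits Γ →
      Der (.subEq (Γ.susIn new F).desusp (Γ.susIn new F).desusp.id
        ((Γ.etaIn F).comp (Γ.etaInv F)) (Γ.susIn new F).desusp)
  | .nil, h, hF => by
      have hs := (h.sus hnew hF).desusp
      exact .seEq (.esEq hs) (.unit .ec) (Finset.notMem_empty _)
        (.eta (.var hs (.inl ⟨rfl, rfl⟩)) (.star hs))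
  | .cons Γ x .unit, h, hF => by
      cases h with
      | ce hA hx =>
        have := hA.ctx_of.etaIn_comp_etaInv hnew hF.tail
        -- A variable of type `𝟙` changes neither `↑Γ` nor `η`; only `η⁻¹` gains an entry.
        rwa [← hA.ctx_of.etaIn_comp_etaInv_cons hnew hF.tail hx] at this
  | .cons Γ x (.hom A t u), h, hF => by
      have hs := (h.sus hnew hF).desusp
      have hs' := hs
      have hu : x ∉ F.units := fun hu => by
        simpa using (hF.units x _ (.inl ⟨rfl, rfl⟩)).1 hu
      cases hs' with
      | ce hB hy =>
        cases h with
        | ce hA hx =>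
          have := (hA.ctx_of.etaIn_comp_etaInv hnew hF.tail).weaken hs fun _ _ h => .inr h
          rw [← hA.ctx_of.etaIn_comp_etaInv_cons hnew hF.tail hx] at this
          refine .seEq this hB hy ?_
          rw [Ty.subst_eq_self fun y => Ctx.get_id y _]
          simp only [Tm.subst, Ctx.etaInv, Sub.get, if_true, Frame.susVar, hu, if_false]
          exact .tmRefl (.var hs (.inl ⟨rfl, rfl⟩))

/-! ### The unit -/

/-- Definitionally equal types are both `𝟙` or both different from `𝟙`, and `η` depends on the types
only through this distinction. -/
theorem CtxEq.etaIn_eq {F : Frame} {Γ Γ' : Ctx} (h : CtxEq Γ Γ') : Γ.etaIn F = Γ'.etaIn F := by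
  induction h with
  | nil => rfl
  | @cons Γ Γ' x A A' _ e ih =>
      -- The component used does not involve `new`, so any function can be inserted, without the
      -- condition `new s ∉ s`.
      have e := (e.sus_eq (new := fun _ => 0)).1
      cases A <;> cases A' <;> simp [Ctx.etaIn, ih] at e ⊢

theorem CtxEq.etaInv_eq {F : Frame} {Γ Γ' : Ctx} (h : CtxEq Γ Γ') : Γ.etaInv F = Γ'.etaInv F := by
  induction h with
  | nil => rfl
  | cons _ _ ih => simp only [Ctx.etaInv, ih]

/-- The component at `X` of the unit, represented by the substitution `η`. -/
def Syn.eta (new : Finset Var → Var) (hnew : ∀ s, new s ∉ s) (X : Syn) :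
    X ⟶ CaTT.desuspension.obj ((reducedSuspension new hnew).obj X) :=
  Quotient.mk (Syn.PreHom.setoid _ _)
    -- All representatives of `X` yield literally the same raw substitution. Lifting the raw
    -- substitution, not the morphism, avoids a lift into a type that depends on `X`.
    { sub := Quotient.lift (fun Γ : VCtx => Γ.ctx.eta new)
        (fun Γ Γ' h => by simp only [Ctx.eta, CtxEq.frame_eq h, CtxEq.etaIn_eq h]) X
      der := by
        induction X using Quotient.ind with
        | _ Γ => exact ⟨Γ, _, rfl, rfl, Γ.der.etaIn hnew (Γ.der.fits hnew)⟩ }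

/-- The component at `X` of the inverse of the unit. -/
def Syn.etaInv (new : Finset Var → Var) (hnew : ∀ s, new s ∉ s) (X : Syn) :
    CaTT.desuspension.obj ((reducedSuspension new hnew).obj X) ⟶ X :=
  Quotient.mk (Syn.PreHom.setoid _ _)
    { sub := Quotient.lift (fun Γ : VCtx => Γ.ctx.etaInv (Γ.ctx.frame new))
        (fun Γ Γ' h => by simp only [CtxEq.frame_eq h, CtxEq.etaInv_eq h]) X
      der := by
        induction X using Quotient.ind with
        | _ Γ => exact ⟨_, Γ, rfl, rfl, Γ.der.etaInv hnew (Γ.der.fits hnew)⟩ }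

theorem Syn.homMk_eq {Δ Γ : VCtx} {γ δ : Sub} (hγ : Der (.sub Δ.ctx γ Γ.ctx))
    (hδ : Der (.sub Δ.ctx δ Γ.ctx)) (h : Der (.subEq Δ.ctx γ δ Γ.ctx)) :
    Syn.homMk γ hγ = Syn.homMk δ hδ :=
  Quotient.sound ⟨Δ, Γ, rfl, rfl, h⟩

variable {new : Finset Var → Var} {hnew : ∀ s, new s ∉ s}

theorem Syn.eta_etaInv (X : Syn) : X.eta new hnew ≫ X.etaInv new hnew = 𝟙 X := by
  induction X using Quotient.ind with
  | _ Γ => exact (Syn.homMk_eq Γ.der.id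
      ((Γ.der.etaInv hnew (Γ.der.fits hnew)).subst (Γ.der.etaIn hnew (Γ.der.fits hnew)))
      (Γ.der.etaInv_comp_etaIn hnew (Γ.der.fits hnew))).symm

theorem Syn.etaInv_eta (X : Syn) : X.etaInv new hnew ≫ X.eta new hnew = 𝟙 _ := by
  induction X using Quotient.ind with
  | _ Γ =>
    have hs := (Γ.der.sus hnew (Γ.der.fits hnew)).desusp
    exact (Syn.homMk_eq (Δ := ⟨_, hs⟩) (Γ := ⟨_, hs⟩) hs.id
      ((Γ.der.etaIn hnew (Γ.der.fits hnew)).subst (Γ.der.etaInv hnew (Γ.der.fits hnew)))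
      (Γ.der.etaIn_comp_etaInv hnew (Γ.der.fits hnew))).symm

/-- The clause for substitutions of `Der.eq_desusp_sus`, read in the syntactic category: it is the
naturality of `η`, solved for `f` by means of `η⁻¹`. -/
theorem Syn.eq_eta_etaInv {X Y : Syn} (f : X ⟶ Y) :
    f = X.eta new hnew ≫ CaTT.desuspension.map ((reducedSuspension new hnew).map f) ≫
      Y.etaInv new hnew := by
  induction X using Quotient.ind with
  | _ Δ => induction Y using Quotient.ind with
    | _ Γ => induction f using Quotient.ind with
      | _ p =>
        have hp := Syn.PreHom.der' p
        have hΔ := Δ.der.fits hnew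
        have hΓ := Γ.der.fits hnew
        exact Syn.homMk_eq hp
          (((Γ.der.etaInv hnew hΓ).subst (hp.sus hnew hΔ hΓ).desusp.1).subst
            (Δ.der.etaIn hnew hΔ))
          (hp.eq_desusp_sus hnew hΔ hΓ)

/-- The unit of the adjunction, as a natural isomorphism. -/
def etaIso (new : Finset Var → Var) (hnew : ∀ s, new s ∉ s) :
    𝟭 Syn ≅ reducedSuspension new hnew ⋙ CaTT.desuspension :=
  NatIso.ofComponents
    (fun X => ⟨X.eta new hnew, X.etaInv new hnew, X.eta_etaInv, X.etaInv_eta⟩)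
    (fun {X Y} f => by
      change f ≫ Y.eta new hnew = X.eta new hnew ≫ CaTT.desuspension.map _
      -- Only the left occurrence of `f` is expanded; composing it with `η_Y` then cancels the
      -- trailing `η_Y⁻¹`.
      conv_lhs => rw [Syn.eq_eta_etaInv (new := new) (hnew := hnew) f]
      simp only [Category.assoc, Syn.etaInv_eta, Category.comp_id])

/-! ### The counit -/

/-- The counit of the adjunction, given by the substitutions `•`. -/
def bulletTrans (new : Finset Var → Var) (hnew : ∀ s, new s ∉ s) :
    CaTT.desuspension ⋙ reducedSuspension new hnew ⟶ 𝟭 CaTT.Syn where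
  app Θ := ⟨Θ.ctx.bullet new, der_bullet hnew (Θ.der.desusp.fits hnew) Θ.der
    (Θ.der.desusp.sus hnew (Θ.der.desusp.fits hnew))⟩
  -- The square is an equality of raw substitutions, `δ ∘ •_Θ = •_Ψ ∘ ↑↓δ`, because morphisms on the
  -- `CaTT` side are not taken up to any equivalence.
  naturality Θ Ψ δ := CaTT.Syn.Hom.ext
    ((δ.der.subst_bullet hnew).2 (Θ.der.desusp.fits hnew) (Ψ.der.desusp.fits hnew)).symm

/-- With this, the triangle identity at `↓Θ` becomes `η` followed by `η⁻¹`. The representatives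
already agree, by `desusp_bullet`. -/
theorem desuspension_map_bulletTrans (Θ : CaTT.Syn) :
    CaTT.desuspension.map ((bulletTrans new hnew).app Θ) =
      (CaTT.desuspension.obj Θ).etaInv new hnew :=
  congrArg (Quotient.mk _) (Syn.PreHom.ext (desusp_bullet _ Θ.ctx))

/-! ### The triangle identities -/

/-- The function `new` is applied to precisely these sets, so `•` receives the same name for `↓↑Γ`
as for `Γ`. Had the name been chosen outside all declared variables, `↓↑Γ`, which declares `•`,
would force a different one. -/
theorem nonUnitVars_desusp_susIn (F : Frame) : ∀ Γ : Ctx,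
    (Γ.susIn new F).desusp.nonUnitVars = Γ.nonUnitVars
  | .nil => rfl
  | .cons Γ _ .unit => nonUnitVars_desusp_susIn F Γ
  | .cons Γ x (.hom _ _ _) => by
      simp only [Ctx.susIn, Ty.sus, CaTT.Ctx.desusp, CaTT.Ty.desusp, Ctx.nonUnitVars,
        nonUnitVars_desusp_susIn F Γ]

theorem unitVars_desusp_susIn (F : Frame) : ∀ Γ : Ctx,
    (Γ.susIn new F).desusp.unitVars = {F.pt}
  | .nil => rfl
  | .cons Γ _ .unit => unitVars_desusp_susIn F Γ
  | .cons Γ x (.hom _ _ _) => by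
      simp only [Ctx.susIn, Ty.sus, CaTT.Ctx.desusp, CaTT.Ty.desusp, Ctx.unitVars,
        unitVars_desusp_susIn F Γ]

theorem frame_desusp_sus (Γ : Ctx) :
    (Γ.sus new).desusp.frame new = ⟨{(Γ.frame new).pt}, (Γ.frame new).pt⟩ := by
  simp only [Ctx.frame, Ctx.sus, nonUnitVars_desusp_susIn, unitVars_desusp_susIn]

/-- A frame whose only variable of type `𝟙` is its own point leaves every variable unchanged. By
`frame_desusp_sus` this applies to `↓↑Γ`, so the counit at `↑Γ` is an identity substitution. -/
theorem bullet_eq_id (p : Var) : ∀ Θ : CaTT.Ctx, Frame.bullet ⟨{p}, p⟩ Θ = Θ.id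
  | .nil => rfl
  | .cons Θ x _ => by
      have : Frame.susVar ⟨{p}, p⟩ x = x := by simp [Frame.susVar, eq_comm]
      simp only [Frame.bullet, CaTT.Ctx.id, bullet_eq_id p Θ, this]

/-- The assignment `• ↦ ()` of `η` is discarded, since `•` has type `𝟙` in the target, and the
assignment `• ↦ •` that every suspended substitution contains takes its place. The other variables
differ from `•`, so their assignments `x ↦ x` are kept. -/
theorem sus_etaIn {F : Frame} : ∀ {Γ : Ctx}, F.Fits Γ →
    (Γ.etaIn F).sus new F ⟨{F.pt}, F.pt⟩ = (Γ.susIn new F).id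
  | .nil, _ => by simp [Ctx.etaIn, Sub.sus, Ctx.susIn, CaTT.Ctx.id]
  | .cons Γ _ .unit, h => sus_etaIn (Γ := Γ) h.tail
  | .cons Γ x (.hom _ _ _), h => by
      have hx := h.pt x _ (.inl ⟨rfl, rfl⟩) (by simp)
      have hu : x ∉ F.units := fun hu => by
        simpa using (h.units x _ (.inl ⟨rfl, rfl⟩)).1 hu
      simp only [Ctx.etaIn, Sub.sus, Finset.mem_singleton, hx, if_false, sus_etaIn h.tail, Tm.sus,
        Frame.susVar, hu, Ctx.susIn, CaTT.Ctx.id]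

/-- By `frame_desusp_sus` both factors are identity substitutions of `↑Γ`, so this triangle identity
holds on raw syntax. -/
theorem map_eta_bulletTrans (X : Syn) : (reducedSuspension new hnew).map (X.eta new hnew) ≫
    (bulletTrans new hnew).app ((reducedSuspension new hnew).obj X) = 𝟙 _ := by
  induction X using Quotient.ind with
  | _ Γ =>
    refine CaTT.Syn.Hom.ext ?_
    change ((Γ.ctx.sus new).bullet new).comp ((Γ.ctx.eta new).sus new (Γ.ctx.frame new)
      ((Γ.ctx.sus new).desusp.frame new)) = (Γ.ctx.sus new).id
    rw [CaTT.Ctx.bullet, frame_desusp_sus, bullet_eq_id, Ctx.eta, sus_etaIn (Γ.der.fits hnew)]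
    exact CaTT.Sub.comp_eq_self (fun x => CaTT.Ctx.get_id x _) _

/-- The reduced suspension is left adjoint to the desuspension. -/
def suspensionAdjunction (new : Finset Var → Var) (hnew : ∀ s, new s ∉ s) :
    reducedSuspension new hnew ⊣ CaTT.desuspension where
  unit := (etaIso new hnew).hom
  counit := bulletTrans new hnew
  left_triangle_components X := map_eta_bulletTrans X
  right_triangle_components Θ := by
    rw [desuspension_map_bulletTrans]
    exact Syn.eta_etaInv _

end MCaTT

-- The coreflective adjunction

theorem mainTheorem1 (new : Finset Var → Var) (hnew : ∀ s, new s ∉ s) :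
    ∃ adj : MCaTT.reducedSuspension new hnew ⊣ CaTT.desuspension,
      (∀ Γ : CaTT.Syn, (adj.counit.app Γ).sub = Γ.ctx.bullet new) ∧
      (∀ Γ : MCaTT.VCtx,
        ∃ h : MCaTT.Der (.sub Γ.ctx (Γ.ctx.eta new) (Γ.ctx.sus new).desusp),
          adj.unit.app (MCaTT.Syn.mk Γ) =
            MCaTT.Syn.homMk
              (Γ := ⟨(Γ.ctx.sus new).desusp,
                ((MCaTT.reducedSuspension new hnew).obj (MCaTT.Syn.mk Γ)).der.desusp⟩)
              (Γ.ctx.eta new) h) ∧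
      IsIso adj.unit ∧
      (MCaTT.reducedSuspension new hnew).Full ∧
      (MCaTT.reducedSuspension new hnew).Faithful := by
  have hiso : IsIso (MCaTT.suspensionAdjunction new hnew).unit :=
    inferInstanceAs (IsIso (MCaTT.etaIso new hnew).hom)
  -- The components of unit and counit were defined from these very substitutions, so on a chosen
  -- representative both descriptions hold by computation.
  refine ⟨MCaTT.suspensionAdjunction new hnew, fun _ => rfl,
    fun Γ => ⟨Γ.der.etaIn hnew (Γ.der.fits hnew), rfl⟩, hiso, ?_, ?_⟩
  -- A left adjoint whose unit is invertible is fully faithful.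
  · exact (MCaTT.suspensionAdjunction new hnew).fullyFaithfulLOfIsIsoUnit.full
  · exact (MCaTT.suspensionAdjunction new hnew).fullyFaithfulLOfIsIsoUnit.faithful
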